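/- Let $a,b,\tau$ be integers with $1\le a\le b$, $\tau+1-a\ge b$ and $b \bmod a=a-1$; put $\ell=\lfloor b/a\rfloor$ (so $b=\ell a+a-1$), $k=\tau+1-a$ and $n=k+b$. *Streaming codes.* A packet-level code over a finite field $\mathbb F_q$ sends at each time $t=0,1,2,\dots$ a coded packet $x(t)=(u(t),p(t))$ consisting of a message packet $u(t)\in\mathbb F_q^{k}$ and a parity packet $p(t)\in\mathbb F_q^{n-k}$ that is a function of $u(0),\dots,u(t)$; its rate is $k/n$. It is an $(a,b,\tau)$ streaming code if every $u(t)$ is determined by the unerased packets among $x(0),\dots,x(t+\tau)$, for every erasure pattern in which each window of $\tau+1$ consecutive time slots contains at most $a$ erasures or has all its erasures inside $b$ consecutive slots. It is rate-optimal if its rate equals $\frac{\tau+1-a}{\tau+1-a+b}$ and no $(a,b,\tau)$ streaming code over any finite field has larger rate. The diagonal embedding of an $[n,k]$ code $\mathbb C$ whose first $k$ symbols form an information set is the packet-level code with $(x_0(t),x_1(t+1),\dots,x_{n-1}(t+n-1))\in\mathbb C$ for all integers $t$, where packets at negative times are zero. *Base code.* Index rows and columns from $0$; $M(i_1:i_2,\,j_1:j_2)$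 denotes the submatrix of $M$ with rows $i_1,\dots,i_2$ and columns $j_1,\dots,j_2$. Let $Z=[Z_1\ Z_2]$ be an $a\times 2a$ zero-band MDS generator matrix over $\mathbb F_q$, i.e. a generator matrix of a $[2a,a]$ MDS code whose entry $(i,j)$ is $0$ whenever $j\equiv i+s \pmod{2a}$ for some $1\le s\le a-1$, with $Z_1,Z_2$ of size $a\times a$. Let $Z_2^*=Z_2(0:a-2,\,0:a-2)$, and let $C$ be a $b\times(\tau+1-b)$ Cauchy matrix, with entries $1/(x_i-y_j)$ where all the $x_i,y_j$ are distinct. Let $\mathbb C^{I}_{a,b,\tau+1}$ be the linear code of length $n$ with the $b\times n$ parity-check matrix $H$ that is zero except for the blocks $H(0:a-2,\,0:a-2)=I_{a-1}$; $H(ia-1:ia+a-2,\;ia-1:ia+a-2)=Z_1$ for $1\le i\le\ell$; $H(0:b-1,\;b:\tau)=C$; $H(a-1:2a-3,\;\tau+1:\tau+a-1)=Z_2^*$; $H(ia-1:(i+1)a-2,\;\tau+(i-1)a:\tau+ia-1)=Z_2$ for $2\le i\le\ell$. *Theorem.* For every finite field $\mathbb F_q$ and every such choice of $Z$ and $C$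 over $\mathbb F_q$, the code $\mathbb C^{I}_{a,b,\tau+1}$ has dimension $k$, its diagonal embedding exists and is unique, and it is a rate-optimal $(a,b,\tau)$ streaming code. Such $Z$ and $C$ exist over every finite field with $q\ge\tau+1$; in particular the field size is $O(\tau)$: some finite field has $\tau+1\le q\le 2\tau$. -/

import Mathlib

namespace StreamingCode

universe u

/-! ### Packet-level codes and streaming codes -/

/-- A causal systematic packet-level code over the alphabet `F`. At time `t = 0, 1, 2, …` the
message packet is `u t ∈ F ^ k` and the parity packet lies in `F ^ r`; the parity packet at time
`t` is a function of the message packets at times `≤ t` only. -/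
structure PacketCode (F : Type u) (k r : ℕ) where
  parity : (ℕ → Fin k → F) → ℕ → Fin r → F
  causal : ∀ (u v : ℕ → Fin k → F) (t : ℕ), (∀ s ≤ t, u s = v s) → parity u t = parity v t

/-- The coded packet at time `t`: the message packet followed by the parity packet. -/
def PacketCode.packet {F : Type u} {k r : ℕ} (P : PacketCode F k r)
    (u : ℕ → Fin k → F) (t : ℕ) : Fin (k + r) → F :=
  Fin.append (u t) (P.parity u t)

/-- The rate: message symbols per code symbol. -/
def PacketCode.rate {F : Type u} {k r : ℕ} (_P : PacketCode F k r) : ℚ :=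
  (k : ℚ) / ((k : ℚ) + (r : ℚ))

/-- The erasure patterns (sets of erased time slots) of the delay-constrained sliding-window
channel: in every window of `τ + 1` consecutive time slots there are either at most `a` erasures,
or all the erasures lie in a burst of `b` consecutive slots. -/
def Admissible (a b τ : ℕ) (E : Set ℕ) : Prop :=
  ∀ t : ℕ, (E ∩ Set.Icc t (t + τ)).ncard ≤ a ∨
    ∃ s : ℕ, E ∩ Set.Icc t (t + τ) ⊆ Set.Ico s (s + b)

/-- An `(a, b, τ)` streaming code: for every admissible erasure pattern and every `t`, the message
packet at time `t` is determined by the coded packets received up to time `t + τ`. -/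
def PacketCode.IsStreaming {F : Type u} {k r : ℕ} (P : PacketCode F k r) (a b τ : ℕ) : Prop :=
  ∀ E : Set ℕ, Admissible a b τ E → ∀ (t : ℕ) (u v : ℕ → Fin k → F),
    (∀ s ≤ t + τ, s ∉ E → P.packet u s = P.packet v s) → u t = v t

/-- The optimal rate `(τ + 1 - a) / (τ + 1 - a + b)`. -/
def optimalRate (a b τ : ℕ) : ℚ :=
  ((τ : ℚ) + 1 - a) / ((τ : ℚ) + 1 - a + b)

/-- A rate-optimal `(a, b, τ)` streaming code: an `(a, b, τ)` streaming code whose rate equals the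
optimal rate and is not exceeded by any `(a, b, τ)` streaming code over any finite field. -/
def PacketCode.IsRateOptimal {F : Type u} {k r : ℕ} (P : PacketCode F k r) (a b τ : ℕ) : Prop :=
  P.IsStreaming a b τ ∧ P.rate = optimalRate a b τ ∧
    ∀ (F' : Type u) [Field F'] [Finite F'] (k' r' : ℕ) (P' : PacketCode F' k' r'),
      P'.IsStreaming a b τ → P'.rate ≤ P.rate

/-- `P` is the diagonal embedding of the block code `C`: along every diagonal of the packet stream,
`(x₀(t), x₁(t + 1), …, x_{n-1}(t + n - 1))` is a codeword of `C`, for every integer `t`, where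
coded packets at negative times are zero. -/
def PacketCode.IsDiagonalEmbedding {F : Type u} [Field F] {k r : ℕ} (P : PacketCode F k r)
    (C : Submodule F (Fin (k + r) → F)) : Prop :=
  ∀ (u : ℕ → Fin k → F) (t : ℤ),
    (fun i : Fin (k + r) =>
      if 0 ≤ t + ((i : ℕ) : ℤ) then P.packet u (t + ((i : ℕ) : ℤ)).toNat i else 0) ∈ C

/-! ### Building blocks of the base code -/

open Classical in
/-- A linear code of length `n` and dimension `k` is MDS if its minimum distance is `n - k + 1`
(the Singleton bound is the reverse inequality). -/
def IsMDS {F : Type u} [Field F] {n : ℕ} (C : Submodule F (Fin n → F)) : Prop :=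
  ∀ c ∈ C, c ≠ 0 → n + 1 ≤ hammingNorm c + Module.finrank F C

/-- A `k × n` zero-band MDS generator matrix: its rows are a basis of an MDS code, and the entry
`(i, j)` is zero whenever `j ∈ [i + 1 : i + k - 1]` modulo `n`. -/
def IsZeroBandMDS {F : Type u} [Field F] {k n : ℕ} (Z : Matrix (Fin k) (Fin n) F) : Prop :=
  LinearIndependent F Z.row ∧ IsMDS (Submodule.span F (Set.range Z.row)) ∧
    ∀ (i : Fin k) (j : Fin n),
      (∃ s : ℕ, 1 ≤ s ∧ s ≤ k - 1 ∧ (j : ℕ) = ((i : ℕ) + s) % n) → Z i j = 0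

/-- A Cauchy matrix: entries `1 / (xᵢ - yⱼ)`, where all `xᵢ` and `yⱼ` are distinct. -/
def IsCauchy {F : Type u} [Field F] {m n : ℕ} (C : Matrix (Fin m) (Fin n) F) : Prop :=
  ∃ (x : Fin m → F) (y : Fin n → F), Function.Injective x ∧ Function.Injective y ∧
    (∀ i j, x i ≠ y j) ∧ ∀ i j, C i j = (x i - y j)⁻¹

/-- The left half `Z₁` of an `a × 2a` matrix. -/
def leftHalf {F : Type u} {a : ℕ} (Z : Matrix (Fin a) (Fin (2 * a)) F) :
    Matrix (Fin a) (Fin a) F :=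
  fun i j => Z i ⟨(j : ℕ), by omega⟩

/-- The right half `Z₂` of an `a × 2a` matrix. -/
def rightHalf {F : Type u} {a : ℕ} (Z : Matrix (Fin a) (Fin (2 * a)) F) :
    Matrix (Fin a) (Fin a) F :=
  fun i j => Z i ⟨a + (j : ℕ), by omega⟩

/-- The block `Z₂*`: the first `a - 1` rows and columns of `Z₂`. -/
def truncatedRightHalf {F : Type u} {a : ℕ} (Z : Matrix (Fin a) (Fin (2 * a)) F) :
    Matrix (Fin (a - 1)) (Fin (a - 1)) F :=
  fun i j => rightHalf Z ⟨(i : ℕ), by omega⟩ ⟨(j : ℕ), by omega⟩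

/-- The entry at row `i` and column `j` of the matrix that is zero except for a copy of `M` whose
top left entry is at row `i₀` and column `j₀`. -/
def placed {F : Type u} [Zero F] {p q : ℕ} (M : Matrix (Fin p) (Fin q) F)
    (i₀ j₀ i j : ℕ) : F :=
  if h : (i₀ ≤ i ∧ i < i₀ + p) ∧ (j₀ ≤ j ∧ j < j₀ + q) then
    M ⟨i - i₀, by omega⟩ ⟨j - j₀, by omega⟩
  else 0

/-! ### The base code -/

/-- The `b × (τ + 1 - a + b)` parity-check matrix of the modified base code, for
`b = ℓ a + (a - 1)`, so that `ℓ = b / a`. The summands occupy disjoint positions. -/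
def parityCheck {F : Type u} [Field F] (a b τ : ℕ) (Z : Matrix (Fin a) (Fin (2 * a)) F)
    (C : Matrix (Fin b) (Fin (τ + 1 - b)) F) : Matrix (Fin b) (Fin (τ + 1 - a + b)) F :=
  fun i j =>
    placed (1 : Matrix (Fin (a - 1)) (Fin (a - 1)) F) 0 0 i j
    + ∑ s ∈ Finset.Icc 1 (b / a), placed (leftHalf Z) (s * a - 1) (s * a - 1) i j
    + placed C 0 b i j
    + placed (truncatedRightHalf Z) (a - 1) (τ + 1) i j
    + ∑ s ∈ Finset.Icc 2 (b / a), placed (rightHalf Z) (s * a - 1) (τ + (s - 1) * a) i j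

/-- The modified base code: the block code with the above parity-check matrix. -/
def baseCode {F : Type u} [Field F] (a b τ : ℕ) (Z : Matrix (Fin a) (Fin (2 * a)) F)
    (C : Matrix (Fin b) (Fin (τ + 1 - b)) F) : Submodule F (Fin (τ + 1 - a + b) → F) :=
  LinearMap.ker (parityCheck a b τ Z C).mulVecLin

end StreamingCode

/-! Take two message streams that agree in all packets received up to time `t + τ`, and suppose
inductively that they agree before `t`. Along each diagonal their difference is a codeword `d` that
vanishes before some index `i < τ + 1 - a`, and one needs `d i = 0` using only the erasures inside
`[i, i + τ]`; later symbols count as unknown.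

The zero band and the MDS property make `Z₁` lower triangular and `Z₂` upper triangular, both with
nonzero diagonals. So `H` splits into a lower triangular head (columns below `b`), a Cauchy middle
(columns `b` to `τ`), and a tail (columns above `τ`) in echelon form. The rows `0, …, a - 2` and `2a
- 2` vanish on the tail, and row `x` vanishes on columns beyond `τ + x`, so unknown symbols past the
deadline do no harm.

In each case one finds at least as many checks meeting only Cauchy columns as there are erased
Cauchy symbols; these symbols then vanish (`SatisfiesChecks.cauchy_eq_zero`). For a burst
(`eq_zero_of_burst`) the checks are the rows before `i` other than the pivots of the erased tail
columns, and row `i` then yields `d i`. For at most `a` erasures (`eq_zero_of_card_le`) they are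
among the `a` rows vanishing on the tail; if `i` lies in a block, independence of any `a` columns of
`Z` finishes. Treating all parity symbols as one burst shows that the first `τ + 1 - a` symbols form
an information set.

Optimality is a counting argument for periodic bursts of length `b` with gaps of `τ + 1 - a` slots.
The matrices come from evaluating polynomials at distinct field elements. -/

namespace StreamingCode

universe u

variable {F : Type u} [Field F]

/-! ### Independence of columns of Cauchy and zero-band MDS matrices. -/

/-- Every square submatrix of a Cauchy matrix is invertible, in the form of a statement on
vanishing linear combinations of columns. -/
theorem IsCauchy.eq_zero_of_sum_eq_zero {m n : ℕ} {C : Matrix (Fin m) (Fin n) F}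
    (hC : IsCauchy C) (T : Finset (Fin m)) (S : Finset (Fin n)) (hcard : S.card ≤ T.card)
    (w : Fin n → F) (h : ∀ i ∈ T, ∑ j ∈ S, C i j * w j = 0) : ∀ j ∈ S, w j = 0 := by
  obtain ⟨x, y, hx, hy, hxy, hC⟩ := hC
  -- The numerator of the rational function `∑ w j / (X - y j)`: it has degree below `S.card`,
  -- vanishes at each `x i` with `i ∈ T`, and its value at `y j` is a nonzero multiple of `w j`.
  set p : Polynomial F := ∑ j ∈ S, Polynomial.C (w j) *
    ∏ l ∈ S.erase j, (Polynomial.X - Polynomial.C (y l)) with hp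
  have hdeg : p.degree < T.card := by
    rcases S.eq_empty_or_nonempty with rfl | hS
    · simp [hp]
    refine lt_of_lt_of_le ?_ (Nat.cast_le.mpr hcard)
    rw [hp]
    refine (Polynomial.degree_sum_le _ _).trans_lt ?_
    rw [Finset.sup_lt_iff (by exact WithBot.bot_lt_coe _)]
    intro j hj
    rw [← Polynomial.smul_eq_C_mul]
    refine (Polynomial.degree_smul_le _ _).trans_lt ?_
    rw [Polynomial.degree_prod]
    simp only [Polynomial.degree_X_sub_C, Finset.sum_const, nsmul_eq_mul, mul_one,
      Finset.card_erase_of_mem hj]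
    exact Nat.cast_lt.mpr (Nat.sub_lt hS.card_pos one_pos)
  have heval : ∀ i ∈ T, p.eval (x i) = 0 := by
    intro i hi
    have h1 : p.eval (x i) = (∏ l ∈ S, (x i - y l)) * ∑ j ∈ S, C i j * w j := by
      rw [hp, Polynomial.eval_finsetSum, Finset.mul_sum]
      refine Finset.sum_congr rfl fun j hj => ?_
      rw [Polynomial.eval_mul, Polynomial.eval_prod, Polynomial.eval_C, hC,
        ← Finset.mul_prod_erase S _ hj]
      have : x i - y j ≠ 0 := sub_ne_zero.mpr (hxy i j)
      simp only [Polynomial.eval_sub, Polynomial.eval_X, Polynomial.eval_C]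
      field_simp
    rw [h1, h i hi, mul_zero]
  have hp0 : p = 0 :=
    Polynomial.eq_zero_of_degree_lt_of_eval_index_eq_zero T (hx.injOn) hdeg heval
  intro j hj
  have h2 : p.eval (y j) = w j * ∏ l ∈ S.erase j, (y j - y l) := by
    rw [hp, Polynomial.eval_finsetSum, Finset.sum_eq_single_of_mem j hj]
    · simp [Polynomial.eval_prod]
    · intro l hl hlj
      rw [Polynomial.eval_mul, Polynomial.eval_prod]
      rw [Finset.prod_eq_zero (i := j) (Finset.mem_erase.mpr ⟨hlj.symm, hj⟩) (by simp), mul_zero]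
  rw [hp0, Polynomial.eval_zero] at h2
  refine (mul_eq_zero.mp h2.symm).resolve_right (Finset.prod_ne_zero_iff.mpr fun l hl => ?_)
  exact sub_ne_zero.mpr fun h => (Finset.mem_erase.mp hl).1 (hy h).symm

section ZeroBand

variable {a : ℕ} {Z : Matrix (Fin a) (Fin (2 * a)) F}

theorem IsZeroBandMDS.finrank_span (hZ : IsZeroBandMDS Z) :
    Module.finrank F (Submodule.span F (Set.range Z.row)) = a := by
  simpa using finrank_span_eq_card hZ.1

theorem IsZeroBandMDS.eq_zero_of_vanishing (hZ : IsZeroBandMDS Z) {c : Fin (2 * a) → F}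
    (hc : c ∈ Submodule.span F (Set.range Z.row)) (T : Finset (Fin (2 * a))) (hT : a ≤ T.card)
    (h : ∀ j ∈ T, c j = 0) : c = 0 := by
  classical
  by_contra h0
  have h1 := hZ.2.1 c hc h0
  rw [hZ.finrank_span] at h1
  have h2 : hammingNorm c ≤ Tᶜ.card := by
    rw [hammingNorm]
    refine Finset.card_le_card fun j hj => ?_
    rw [Finset.mem_compl]
    intro hjT
    exact (Finset.mem_filter.mp hj).2 (h j hjT)
  have h3 := Finset.card_compl_add_card T
  simp only [Fintype.card_fin] at h3
  have : 2 * a + 1 ≤ hammingNorm c + a := by convert h1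
  omega

/-- Any `a` columns of the generator matrix of a `[2a, a]` MDS code are independent. -/
theorem IsZeroBandMDS.eq_zero_of_sum_eq_zero (hZ : IsZeroBandMDS Z) (w : Fin (2 * a) → F)
    (T : Finset (Fin (2 * a))) (hT : T.card ≤ a) (hw : ∀ j ∉ T, w j = 0)
    (h : ∀ i, ∑ j, Z i j * w j = 0) : w = 0 := by
  classical
  obtain ⟨T', hTT', hT'⟩ := Finset.exists_superset_card_eq hT (by simp; omega)
  let φ : (Fin a → F) →ₗ[F] (T' → F) :=
    (LinearMap.funLeft F F (fun j : T' => (j : Fin (2 * a)))).comp Z.vecMulLinear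
  have hφ : ∀ v j, φ v j = ∑ i, v i * Z i j := fun v j => rfl
  have hinj : Function.Injective φ := by
    rw [← LinearMap.ker_eq_bot, LinearMap.ker_eq_bot']
    intro v hv
    have h1 : Matrix.vecMul v Z = 0 := by
      refine hZ.eq_zero_of_vanishing ?_ T' hT'.ge fun j hj => congrFun hv ⟨j, hj⟩
      rw [Matrix.vecMul_eq_sum]
      exact Submodule.sum_mem _ fun i _ =>
        Submodule.smul_mem _ _ (Submodule.subset_span ⟨i, rfl⟩)
    have h2 := Fintype.linearIndependent_iff.mp hZ.1 v (by rw [← h1, Matrix.vecMul_eq_sum]; rfl)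
    exact funext h2
  have hsurj : Function.Surjective φ :=
    (LinearMap.injective_iff_surjective_of_finrank_eq_finrank (by simp [hT'])).mp hinj
  funext j
  by_cases hj : j ∈ T'
  · obtain ⟨v, hv⟩ := hsurj (Pi.single ⟨j, hj⟩ 1)
    have h1 : ∑ l, (∑ i, v i * Z i l) * w l = w j := by
      rw [Finset.sum_eq_single j]
      · rw [← hφ v ⟨j, hj⟩, hv]; simp
      · intro l _ hlj
        by_cases hl : l ∈ T'
        · rw [← hφ v ⟨l, hl⟩, hv, Pi.single_eq_of_ne (by simpa [Subtype.ext_iff] using hlj), zero_mul]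
        · rw [hw l fun h => hl (hTT' h), mul_zero]
      · simp
    rw [← h1]
    simp_rw [Finset.sum_mul]
    rw [Finset.sum_comm]
    refine Finset.sum_eq_zero fun i _ => ?_
    simp_rw [mul_assoc]
    rw [← Finset.mul_sum, h i, mul_zero]
  · exact hw j fun h => hj (hTT' h)

theorem IsZeroBandMDS.apply_eq_zero (hZ : IsZeroBandMDS Z) (i : Fin a) (j : Fin (2 * a))
    (h1 : (i : ℕ) < j) (h2 : (j : ℕ) < i + a) : Z i j = 0 :=
  hZ.2.2 i j ⟨j - i, by omega, by omega, by
    rw [Nat.mod_eq_of_lt (by omega)]; omega⟩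

/-- Row `i` already has `a - 1` zeros in its band; an `a`-th zero would make it the zero codeword,
against independence of the rows. -/
theorem IsZeroBandMDS.apply_ne_zero (hZ : IsZeroBandMDS Z) (i : Fin a) (j : Fin (2 * a))
    (h : (j : ℕ) ≤ i ∨ (i : ℕ) + a ≤ j) : Z i j ≠ 0 := by
  classical
  intro h0
  refine hZ.1.ne_zero i ?_
  refine hZ.eq_zero_of_vanishing (Submodule.subset_span ⟨i, rfl⟩)
    (insert j ((Finset.univ : Finset (Fin (a - 1))).map
      ⟨fun s : Fin (a - 1) => (⟨(i : ℕ) + 1 + s, by have := i.2; have := s.2; omega⟩ : Fin (2 * a)), fun s t hst => by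
        simp only [Fin.mk.injEq] at hst; omega⟩)) ?_ ?_
  · rw [Finset.card_insert_of_notMem]
    · rw [Finset.card_map, Finset.card_univ, Fintype.card_fin]; omega
    · rw [Finset.mem_map]
      rintro ⟨s, -, rfl⟩
      have h : (i : ℕ) + 1 + s ≤ i ∨ (i : ℕ) + a ≤ i + 1 + s := h
      omega
  · intro l hl
    rcases Finset.mem_insert.mp hl with rfl | hl
    · exact h0
    · obtain ⟨s, -, rfl⟩ := Finset.mem_map.mp hl
      exact hZ.apply_eq_zero i _ (show (i : ℕ) < i + 1 + s by omega)
        (show (i : ℕ) + 1 + s < i + a by omega)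

end ZeroBand

end StreamingCode

/-! ### The shape of the parity-check matrix: triangular head, Cauchy middle, echelon tail. -/

namespace StreamingCode

universe u

variable {F : Type u} [Field F]

/-- The matrix `M` with its entries indexed by natural numbers, extended by zero. -/
def natEntry {m n : ℕ} (M : Matrix (Fin m) (Fin n) F) (i j : ℕ) : F :=
  if h : i < m ∧ j < n then M ⟨i, h.1⟩ ⟨j, h.2⟩ else 0

theorem natEntry_val {m n : ℕ} (M : Matrix (Fin m) (Fin n) F) (i : Fin m) (j : Fin n) :
    natEntry M i j = M i j := by
  simp [natEntry]

theorem placed_eq {p q : ℕ} (M : Matrix (Fin p) (Fin q) F) (i₀ j₀ i j : ℕ) :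
    placed M i₀ j₀ i j =
      if (i₀ ≤ i ∧ i < i₀ + p) ∧ (j₀ ≤ j ∧ j < j₀ + q) then natEntry M (i - i₀) (j - j₀) else 0 := by
  unfold placed natEntry
  split_ifs with h h'
  · rfl
  · omega
  · rfl

theorem natEntry_leftHalf {a : ℕ} (Z : Matrix (Fin a) (Fin (2 * a)) F) {i j : ℕ} (hj : j < a) :
    natEntry (leftHalf Z) i j = natEntry Z i j := by
  unfold natEntry leftHalf
  split_ifs <;> first | rfl | omega

theorem natEntry_rightHalf {a : ℕ} (Z : Matrix (Fin a) (Fin (2 * a)) F) (i j : ℕ) :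
    natEntry (rightHalf Z) i j = natEntry Z i (a + j) := by
  unfold natEntry rightHalf
  split_ifs <;> first | rfl | omega

theorem natEntry_truncatedRightHalf {a : ℕ} (Z : Matrix (Fin a) (Fin (2 * a)) F) {i j : ℕ}
    (hi : i < a - 1) (hj : j < a - 1) :
    natEntry (truncatedRightHalf Z) i j = natEntry Z i (a + j) := by
  unfold natEntry truncatedRightHalf rightHalf
  split_ifs <;> first | rfl | omega

theorem IsZeroBandMDS.natEntry_eq_zero {a : ℕ} {Z : Matrix (Fin a) (Fin (2 * a)) F}
    (hZ : IsZeroBandMDS Z) {i j : ℕ} (h1 : i < j) (h2 : j < i + a) : natEntry Z i j = 0 := by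
  unfold natEntry
  split_ifs with h
  · exact hZ.apply_eq_zero _ _ h1 h2
  · rfl

theorem IsZeroBandMDS.natEntry_ne_zero {a : ℕ} {Z : Matrix (Fin a) (Fin (2 * a)) F}
    (hZ : IsZeroBandMDS Z) {i j : ℕ} (hi : i < a) (hj : j < 2 * a) (h : j ≤ i ∨ i + a ≤ j) :
    natEntry Z i j ≠ 0 := by
  unfold natEntry
  rw [dif_pos ⟨hi, hj⟩]
  exact hZ.apply_ne_zero _ _ h

/-- The entries of the parity-check matrix, indexed by natural numbers. -/
def checkEntry (a b τ : ℕ) (Z : Matrix (Fin a) (Fin (2 * a)) F)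
    (C : Matrix (Fin b) (Fin (τ + 1 - b)) F) (i j : ℕ) : F :=
  placed (1 : Matrix (Fin (a - 1)) (Fin (a - 1)) F) 0 0 i j
    + ∑ s ∈ Finset.Icc 1 (b / a), placed (leftHalf Z) (s * a - 1) (s * a - 1) i j
    + placed C 0 b i j
    + placed (truncatedRightHalf Z) (a - 1) (τ + 1) i j
    + ∑ s ∈ Finset.Icc 2 (b / a), placed (rightHalf Z) (s * a - 1) (τ + (s - 1) * a) i j

/-- The parameters of the construction: `b = ℓ a + (a - 1)` with `ℓ ≥ 1`, and `a + b ≤ τ + 1`. -/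
structure Params (a b τ l : ℕ) : Prop where
  a_pos : 1 ≤ a
  l_pos : 1 ≤ l
  div_eq : b / a = l
  b_eq : b = l * a + (a - 1)
  le : a + b ≤ τ + 1

/-- The first column of the right-hand block in the block of rows `g`. -/
def tailStart (a τ g : ℕ) : ℕ := if g = 1 then τ + 1 else τ + (g - 1) * a

section Entries

variable {a b τ l : ℕ} (hp : Params a b τ l) (Z : Matrix (Fin a) (Fin (2 * a)) F)
  (C : Matrix (Fin b) (Fin (τ + 1 - b)) F)

include hp

theorem Params.block_le {g : ℕ} (hg : g ≤ l) : g * a + (a - 1) ≤ b := by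
  have := Nat.mul_le_mul_right a hg
  have := hp.b_eq
  omega

theorem Params.block_unique {s g r : ℕ} (hs : 1 ≤ s) (hg : 1 ≤ g) (hr : r < a)
    (h1 : s * a - 1 ≤ g * a - 1 + r) (h2 : g * a - 1 + r < s * a - 1 + a) : s = g := by
  have h3 := Nat.le_mul_of_pos_left a hs
  have h4 := Nat.le_mul_of_pos_left a hg
  have := hp.a_pos
  rcases lt_trichotomy s g with h | h | h
  · have := Nat.mul_le_mul_right a (Nat.succ_le_of_lt h)
    rw [Nat.succ_mul] at this
    omega
  · exact h
  · have := Nat.mul_le_mul_right a (Nat.succ_le_of_lt h)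
    rw [Nat.succ_mul] at this
    omega

/-- Every row is one of the first `a - 1` rows or lies in one of `l` blocks of `a` rows. -/
theorem Params.row_cases {i : ℕ} (hi : i < b) :
    i < a - 1 ∨ ∃ g r, 1 ≤ g ∧ g ≤ l ∧ r < a ∧ i = g * a - 1 + r := by
  have ha := hp.a_pos
  rcases lt_or_ge i (a - 1) with h | h
  · exact Or.inl h
  · refine Or.inr ⟨(i + 1) / a, (i + 1) % a, ?_, ?_, Nat.mod_lt _ ha, ?_⟩
    · exact (Nat.one_le_div_iff ha).mpr (by omega)
    · rw [← Nat.lt_succ_iff, Nat.div_lt_iff_lt_mul ha, Nat.succ_mul]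
      have := hp.b_eq
      omega
    · have h1 := Nat.div_add_mod' (i + 1) a
      have h2 : a ≤ (i + 1) / a * a :=
        Nat.le_mul_of_pos_left a ((Nat.one_le_div_iff ha).mpr (by omega))
      omega

/-- Rows of the first block. -/
theorem checkEntry_first {i j : ℕ} (hi : i < a - 1) :
    checkEntry a b τ Z C i j =
      if j = i then 1 else if b ≤ j ∧ j ≤ τ then natEntry C i (j - b) else 0 := by
  have hb := hp.block_le (le_refl l)
  have hl := Nat.le_mul_of_pos_left a hp.l_pos
  have hle := hp.le
  unfold checkEntry
  rw [Finset.sum_eq_zero, Finset.sum_eq_zero]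
  · simp only [placed_eq]
    rw [if_neg (c := (a - 1 ≤ i ∧ _) ∧ _) (by omega)]
    by_cases hji : j = i
    · subst hji
      rw [if_pos (by omega), if_neg (by omega), if_pos rfl]
      simp [natEntry, hi]
    · rw [if_neg hji]
      have h1 : (if (0 ≤ i ∧ i < 0 + (a - 1)) ∧ 0 ≤ j ∧ j < 0 + (a - 1) then
          natEntry (1 : Matrix (Fin (a - 1)) (Fin (a - 1)) F) (i - 0) (j - 0) else 0) = 0 := by
        split_ifs with h
        · unfold natEntry
          rw [dif_pos (by omega), Matrix.one_apply_ne]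
          simp only [ne_eq, Fin.mk.injEq]
          omega
        · rfl
      rw [h1]
      by_cases hj : b ≤ j ∧ j ≤ τ
      · rw [if_pos (by omega), if_pos hj]; simp
      · rw [if_neg (by omega), if_neg hj]; simp
  · intro s hs
    have := Nat.le_mul_of_pos_left a (show 1 ≤ s from by have := (Finset.mem_Icc.mp hs).1; omega)
    rw [placed_eq, if_neg (by omega)]
  · intro s hs
    have := Nat.le_mul_of_pos_left a (Finset.mem_Icc.mp hs).1
    rw [placed_eq, if_neg (by omega)]

/-- Rows of the block `g ≥ 1`. -/
theorem checkEntry_block (hZ : IsZeroBandMDS Z) {g r j : ℕ} (hg : 1 ≤ g) (hgl : g ≤ l)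
    (hr : r < a) :
    checkEntry a b τ Z C (g * a - 1 + r) j =
      (if g * a - 1 ≤ j ∧ j < g * a - 1 + a then natEntry Z r (j - (g * a - 1)) else 0)
      + (if b ≤ j ∧ j ≤ τ then natEntry C (g * a - 1 + r) (j - b) else 0)
      + (if tailStart a τ g ≤ j ∧ j < τ + g * a then
          natEntry Z r (a + (j - tailStart a τ g)) else 0) := by
  have hb := hp.block_le hgl
  have hga := Nat.le_mul_of_pos_left a hg
  have hle := hp.le
  have ha := hp.a_pos
  unfold checkEntry
  have e1 : placed (1 : Matrix (Fin (a - 1)) (Fin (a - 1)) F) 0 0 (g * a - 1 + r) j = 0 := by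
    rw [placed_eq, if_neg (by omega)]
  have e2 : ∑ s ∈ Finset.Icc 1 (b / a), placed (leftHalf Z) (s * a - 1) (s * a - 1)
      (g * a - 1 + r) j =
      if g * a - 1 ≤ j ∧ j < g * a - 1 + a then natEntry Z r (j - (g * a - 1)) else 0 := by
    rw [Finset.sum_eq_single_of_mem g (Finset.mem_Icc.mpr ⟨hg, by rw [hp.div_eq]; exact hgl⟩)]
    · rw [placed_eq]
      by_cases hj : g * a - 1 ≤ j ∧ j < g * a - 1 + a
      · rw [if_pos (by omega), if_pos hj, natEntry_leftHalf Z (by omega), Nat.add_sub_cancel_left]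
      · rw [if_neg (by omega), if_neg hj]
    · intro s hs hsg
      rw [placed_eq, if_neg]
      rintro ⟨⟨h1, h2⟩, -⟩
      exact hsg (hp.block_unique (Finset.mem_Icc.mp hs).1 hg hr h1 h2)
  have e3 : placed C 0 b (g * a - 1 + r) j =
      if b ≤ j ∧ j ≤ τ then natEntry C (g * a - 1 + r) (j - b) else 0 := by
    rw [placed_eq]
    by_cases hj : b ≤ j ∧ j ≤ τ
    · rw [if_pos (by omega), if_pos hj, Nat.sub_zero]
    · rw [if_neg (by omega), if_neg hj]
  rw [e1, e2, e3, zero_add, add_assoc (_ + _)]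
  congr 1
  rcases hg.eq_or_lt with rfl | hg1
  · have e4 : ∑ s ∈ Finset.Icc 2 (b / a), placed (rightHalf Z) (s * a - 1) (τ + (s - 1) * a)
        (1 * a - 1 + r) j = 0 := by
      refine Finset.sum_eq_zero fun s hs => ?_
      have hs2 := (Finset.mem_Icc.mp hs).1
      rw [placed_eq, if_neg]
      rintro ⟨⟨h1, h2⟩, -⟩
      have := hp.block_unique (by omega) hg hr h1 h2
      omega
    rw [e4, add_zero, placed_eq]
    simp only [tailStart, if_true, one_mul]
    by_cases hj : τ + 1 ≤ j ∧ j < τ + a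
    · rw [if_pos hj]
      by_cases hr' : r < a - 1
      · rw [if_pos (by omega), natEntry_truncatedRightHalf Z (by omega) (by omega),
          Nat.add_sub_cancel_left]
      -- The last row of `Z₂` vanishes on the first `a - 1` columns, so leaving it out of `Z₂*`
      -- changes nothing and block `1` obeys the same formula as the others.
      · rw [if_neg (by omega), hZ.natEntry_eq_zero (by omega) (by omega)]
    · rw [if_neg (by omega), if_neg hj]
  · have e4 : placed (truncatedRightHalf Z) (a - 1) (τ + 1) (g * a - 1 + r) j = 0 := by
      have := Nat.mul_le_mul_right a (show 2 ≤ g from hg1)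
      rw [placed_eq, if_neg (by omega)]
    rw [e4, zero_add, Finset.sum_eq_single_of_mem g
      (Finset.mem_Icc.mpr ⟨hg1, by rw [hp.div_eq]; exact hgl⟩)]
    · rw [placed_eq]
      have e5 : tailStart a τ g = τ + (g - 1) * a := if_neg (by omega)
      have e6 : (g - 1) * a + a = g * a := by
        rw [← Nat.succ_mul]; congr 1; omega
      rw [e5]
      by_cases hj : τ + (g - 1) * a ≤ j ∧ j < τ + g * a
      · rw [if_pos (by omega), if_pos hj, natEntry_rightHalf, Nat.add_sub_cancel_left]
      · rw [if_neg (by omega), if_neg hj]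
    · intro s hs hsg
      have hs2 := (Finset.mem_Icc.mp hs).1
      rw [placed_eq, if_neg]
      rintro ⟨⟨h1, h2⟩, -⟩
      exact hsg (hp.block_unique (by omega) hg hr h1 h2)

/-- Linear facts with `g * a` as an atom, ready for `omega`: the right block has `a` columns for `g
≥ 2` but only `a - 1` for `g = 1`. -/
theorem Params.tailStart_bounds {g : ℕ} (hg : 1 ≤ g) :
    τ + 1 ≤ tailStart a τ g ∧ τ + g * a ≤ tailStart a τ g + a ∧
      tailStart a τ g ≤ τ + g * a ∧ tailStart a τ g + a ≤ τ + g * a + 1 ∧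
      (2 ≤ g → tailStart a τ g + a = τ + g * a) ∧ (g = 1 → tailStart a τ g = τ + 1) := by
  have ha := hp.a_pos
  have hga := Nat.le_mul_of_pos_left a hg
  unfold tailStart
  rcases hg.eq_or_lt with rfl | hg1
  · simp; omega
  · have := Nat.le_mul_of_pos_left a (show 1 ≤ g - 1 by omega)
    have e6 : (g - 1) * a + a = g * a := by
      rw [← Nat.succ_mul]; congr 1; omega
    rw [if_neg (by omega)]
    omega

theorem checkEntry_cauchy (hZ : IsZeroBandMDS Z) {i j : ℕ} (hi : i < b) (h1 : b ≤ j)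
    (h2 : j ≤ τ) : checkEntry a b τ Z C i j = natEntry C i (j - b) := by
  have hb := hp.block_le le_rfl
  have hl := Nat.le_mul_of_pos_left a hp.l_pos
  rcases hp.row_cases hi with h | ⟨g, r, hg, hgl, hr, rfl⟩
  · rw [checkEntry_first hp Z C h, if_neg (by omega), if_pos ⟨h1, h2⟩]
  · have := hp.tailStart_bounds hg
    have := hp.block_le hgl
    have := Nat.le_mul_of_pos_left a hg
    rw [checkEntry_block hp Z C hZ hg hgl hr, if_neg (by omega), if_pos ⟨h1, h2⟩,
      if_neg (by omega), zero_add, add_zero]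

/-- The left part of the matrix is lower triangular. -/
theorem checkEntry_head_eq_zero (hZ : IsZeroBandMDS Z) {i j : ℕ} (hij : i < j) (hj : j < b) :
    checkEntry a b τ Z C i j = 0 := by
  have hle := hp.le
  rcases hp.row_cases (hij.trans hj) with h | ⟨g, r, hg, hgl, hr, rfl⟩
  · rw [checkEntry_first hp Z C h, if_neg (by omega), if_neg (by omega)]
  · have := hp.tailStart_bounds hg
    rw [checkEntry_block hp Z C hZ hg hgl hr, if_neg (c := b ≤ j ∧ _) (by omega),
      if_neg (c := _ ≤ j ∧ j < τ + _) (by omega), add_zero, add_zero]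
    split_ifs with h
    · exact hZ.natEntry_eq_zero (by omega) (by omega)
    · rfl

theorem checkEntry_diag_ne_zero (hZ : IsZeroBandMDS Z) {i : ℕ} (hi : i < b) :
    checkEntry a b τ Z C i i ≠ 0 := by
  have hle := hp.le
  rcases hp.row_cases hi with h | ⟨g, r, hg, hgl, hr, rfl⟩
  · rw [checkEntry_first hp Z C h, if_pos rfl]
    exact one_ne_zero
  · have := hp.tailStart_bounds hg
    rw [checkEntry_block hp Z C hZ hg hgl hr, if_neg (c := b ≤ _ ∧ _) (by omega),
      if_neg (c := _ ≤ _ ∧ _ < τ + _) (by omega), add_zero, add_zero, if_pos (by omega),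
      Nat.add_sub_cancel_left]
    exact hZ.natEntry_ne_zero hr (by omega) (Or.inl le_rfl)

theorem checkEntry_tail_first {i j : ℕ} (hi : i < a - 1) (hj : τ < j) :
    checkEntry a b τ Z C i j = 0 := by
  have hle := hp.le
  rw [checkEntry_first hp Z C hi, if_neg (by omega), if_neg (by omega)]

theorem checkEntry_tail_block (hZ : IsZeroBandMDS Z) {g r j : ℕ} (hg : 1 ≤ g) (hgl : g ≤ l)
    (hr : r < a) (hj : τ < j) : checkEntry a b τ Z C (g * a - 1 + r) j =
      if tailStart a τ g ≤ j ∧ j < τ + g * a then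
          natEntry Z r (a + (j - tailStart a τ g)) else 0 := by
  have hle := hp.le
  have := hp.block_le hgl
  have := Nat.le_mul_of_pos_left a hg
  rw [checkEntry_block hp Z C hZ hg hgl hr, if_neg (c := b ≤ _ ∧ _) (by omega),
      if_neg (c := _ ≤ _ ∧ _ < g * a - 1 + a) (by omega), add_zero, zero_add]

/-- The row `2 a - 2` vanishes on the right part of the matrix. -/
theorem checkEntry_tail_last (hZ : IsZeroBandMDS Z) {j : ℕ} (hj : τ < j) :
    checkEntry a b τ Z C (2 * a - 2) j = 0 := by
  have ha := hp.a_pos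
  have h := checkEntry_tail_block hp Z C hZ le_rfl hp.l_pos (show a - 1 < a by omega) hj
  rw [show 1 * a - 1 + (a - 1) = 2 * a - 2 by omega] at h
  rw [h]
  have := hp.tailStart_bounds le_rfl
  split_ifs with h
  · exact hZ.natEntry_eq_zero (by omega) (by omega)
  · rfl

/-- A row `i` vanishes on the columns `j > τ + i` of the right part. -/
theorem checkEntry_tail_far (hZ : IsZeroBandMDS Z) {i j : ℕ} (hi : i < b) (hj : τ + i < j) :
    checkEntry a b τ Z C i j = 0 := by
  rcases hp.row_cases hi with h | ⟨g, r, hg, hgl, hr, rfl⟩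
  · exact checkEntry_tail_first hp Z C h (by omega)
  · have := Nat.le_mul_of_pos_left a hg
    rw [checkEntry_tail_block hp Z C hZ hg hgl hr (by omega), if_neg (by omega)]

/-- The row of the pivot of the column `τ + 1 + s`. -/
def pivotRow (a s : ℕ) : ℕ := if s < a - 1 then a - 1 + s else a + s

omit hp in
theorem pivotRow_strictMono : StrictMono (pivotRow a) := by
  intro s t h
  unfold pivotRow
  split_ifs <;> omega

/-- Below its pivot, a column of the right part vanishes. -/
theorem checkEntry_tail_below (hZ : IsZeroBandMDS Z) {i s : ℕ} (hi : i < b)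
    (h : pivotRow a s < i) : checkEntry a b τ Z C i (τ + 1 + s) = 0 := by
  rcases hp.row_cases hi with h' | ⟨g, r, hg, hgl, hr, rfl⟩
  · exact checkEntry_tail_first hp Z C h' (by omega)
  · have hts := hp.tailStart_bounds hg
    have hga := Nat.le_mul_of_pos_left a hg
    rw [checkEntry_tail_block hp Z C hZ hg hgl hr (by omega)]
    split_ifs with h2
    · refine hZ.natEntry_eq_zero (by omega) ?_
      unfold pivotRow at h
      rcases hg.eq_or_lt with rfl | hg1
      · have := hts.2.2.2.2.2 rfl
        split_ifs at h <;> omega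
      · have := hts.2.2.2.2.1 hg1
        have := Nat.mul_le_mul_right a (show 2 ≤ g from hg1)
        split_ifs at h <;> omega
    · rfl

/-- The pivots are the diagonal entries of `Z₂*` and of the copies of `Z₂`. The jump in `pivotRow`
skips row `2a - 2`, whose pivot was in the truncated column. -/
theorem checkEntry_pivot_ne_zero (hZ : IsZeroBandMDS Z) {s : ℕ} (hi : pivotRow a s < b) :
    checkEntry a b τ Z C (pivotRow a s) (τ + 1 + s) ≠ 0 := by
  have ha := hp.a_pos
  rcases hp.row_cases hi with h' | ⟨g, r, hg, hgl, hr, h⟩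
  · exfalso; unfold pivotRow at h'; split_ifs at h' <;> omega
  · have hts := hp.tailStart_bounds hg
    have hga := Nat.le_mul_of_pos_left a hg
    rw [h, checkEntry_tail_block hp Z C hZ hg hgl hr (by omega)]
    unfold pivotRow at h
    rcases hg.eq_or_lt with rfl | hg1
    · have := hts.2.2.2.2.2 rfl
      split_ifs at h
      · rw [if_pos (by omega)]
        exact hZ.natEntry_ne_zero hr (by omega) (by omega)
      · omega
    · have := hts.2.2.2.2.1 hg1
      have := Nat.mul_le_mul_right a (show 2 ≤ g from hg1)
      split_ifs at h
      · omega
      · rw [if_pos (by omega)]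
        exact hZ.natEntry_ne_zero hr (by omega) (by omega)

/-- A row that is not a pivot row vanishes on the right part. -/
theorem checkEntry_tail_of_forall_pivotRow_ne (hZ : IsZeroBandMDS Z) {i j : ℕ} (hj : τ < j)
    (h : ∀ s, pivotRow a s ≠ i) : checkEntry a b τ Z C i j = 0 := by
  have ha := hp.a_pos
  have hi : i < a - 1 ∨ i = 2 * a - 2 := by
    by_contra! hc
    rcases lt_or_gt_of_ne hc.2 with h1 | h1
    · exact h (i - (a - 1)) (by unfold pivotRow; split_ifs <;> omega)
    · exact h (i - a) (by unfold pivotRow; split_ifs <;> omega)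
  rcases hi with hi | rfl
  · exact checkEntry_tail_first hp Z C hi hj
  · exact checkEntry_tail_last hp Z C hZ hj

end Entries

end StreamingCode

/-! ### Recovery of erased symbols in the base code. -/

namespace StreamingCode

universe u

variable {F : Type u} [Field F] {a b τ l : ℕ}

section Code

variable (hp : Params a b τ l) {Z : Matrix (Fin a) (Fin (2 * a)) F}
  {C : Matrix (Fin b) (Fin (τ + 1 - b)) F} {d : ℕ → F}

include hp in
theorem Params.a_le_b : a ≤ b := by
  have := hp.block_le hp.l_pos
  omega

theorem mem_baseCode_iff (Z : Matrix (Fin a) (Fin (2 * a)) F)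
    (C : Matrix (Fin b) (Fin (τ + 1 - b)) F) (c : Fin (τ + 1 - a + b) → F) :
    c ∈ baseCode a b τ Z C ↔
      ∀ i < b, ∑ j : Fin (τ + 1 - a + b), checkEntry a b τ Z C i j * c j = 0 := by
  rw [baseCode, LinearMap.mem_ker]
  constructor
  · exact fun h i hi => congrFun h ⟨i, hi⟩
  · exact fun h => funext fun i => h i i.2

/-- The check equations for a sequence `d` supported on `[0, τ + 1 - a + b)`. -/
def SatisfiesChecks (a b τ : ℕ) (Z : Matrix (Fin a) (Fin (2 * a)) F)
    (C : Matrix (Fin b) (Fin (τ + 1 - b)) F) (d : ℕ → F) : Prop :=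
  ∀ i < b, ∑ j ∈ Finset.range (τ + 1 - a + b), checkEntry a b τ Z C i j * d j = 0

theorem satisfiesChecks_of_mem {c : Fin (τ + 1 - a + b) → F} (hc : c ∈ baseCode a b τ Z C) :
    SatisfiesChecks a b τ Z C fun j => if h : j < τ + 1 - a + b then c ⟨j, h⟩ else 0 := by
  intro i hi
  rw [Finset.sum_range]
  refine Eq.trans (Finset.sum_congr rfl fun j _ => ?_) ((mem_baseCode_iff Z C c).mp hc i hi)
  simp only [dif_pos j.2]

include hp in
/-- If enough check equations see only the Cauchy columns, the Cauchy part of the codeword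
vanishes. -/
theorem SatisfiesChecks.cauchy_eq_zero (hd : SatisfiesChecks a b τ Z C d)
    (hZ : IsZeroBandMDS Z) (hC : IsCauchy C) (T S : Finset ℕ) (hcard : S.card ≤ T.card)
    (hT : ∀ i ∈ T, i < b) (hS : ∀ j ∈ S, b ≤ j ∧ j ≤ τ)
    (hdS : ∀ j, b ≤ j → j ≤ τ → j ∉ S → d j = 0)
    (h : ∀ i ∈ T, ∀ j < τ + 1 - a + b, (j < b ∨ τ < j) →
      checkEntry a b τ Z C i j = 0 ∨ d j = 0) :
    ∀ j, b ≤ j → j ≤ τ → d j = 0 := by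
  classical
  have hle := hp.le
  have hab := hp.a_le_b
  intro j h1 h2
  by_contra hj
  have hjS : j ∈ S := by_contra fun hS => hj (hdS j h1 h2 hS)
  let T' : Finset (Fin b) := T.attachFin hT
  let S' : Finset (Fin (τ + 1 - b)) := Finset.univ.filter fun j => b + (j : ℕ) ∈ S
  have hSmap : S = S'.image fun j : Fin (τ + 1 - b) => b + (j : ℕ) := by
    ext x
    simp only [S', Finset.mem_image, Finset.mem_filter, Finset.mem_univ, true_and]
    constructor
    · intro hx
      have := hS x hx
      have e : b + (x - b) = x := by omega
      exact ⟨⟨x - b, by omega⟩, by simpa only [e] using hx, e⟩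
    · rintro ⟨y, hy, rfl⟩
      exact hy
  have hScard : S.card = S'.card := by
    conv_lhs => rw [hSmap]
    exact Finset.card_image_of_injective _ fun x y hxy => Fin.ext (by simpa using hxy)
  refine hj ?_
  have key := hC.eq_zero_of_sum_eq_zero T' S' (by rw [Finset.card_attachFin, ← hScard]; exact hcard)
    (fun j => d (b + j)) ?_ ⟨j - b, by omega⟩ ?_
  · have e : b + (j - b) = j := by omega
    simpa only [e] using key
  · intro i hi
    have hi' : (i : ℕ) ∈ T := Finset.mem_attachFin hT |>.mp hi
    rw [← hd i i.2]
    have hsub : S ⊆ Finset.range (τ + 1 - a + b) := fun x hx =>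
      Finset.mem_range.mpr (by have := hS x hx; omega)
    rw [← Finset.sum_subset hsub]
    · rw [hSmap, Finset.sum_image fun x _ y _ hxy => Fin.ext (by simpa using hxy)]
      refine Finset.sum_congr rfl fun x _ => ?_
      rw [checkEntry_cauchy hp Z C hZ i.2 (by omega) (by omega), Nat.add_sub_cancel_left,
        natEntry_val]
    · intro x hx hxS
      rw [Finset.mem_range] at hx
      by_cases hx' : b ≤ x ∧ x ≤ τ
      · rw [hdS x hx'.1 hx'.2 hxS, mul_zero]
      · exact mul_eq_zero.mpr (h i hi' x hx (by omega))
  · simp only [S', Finset.mem_filter, Finset.mem_univ, true_and]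
    have e : b + (j - b) = j := by omega
    rwa [e]

theorem SatisfiesChecks.eq_zero_of_row (hd : SatisfiesChecks a b τ Z C d) {i j : ℕ} (hi : i < b)
    (hj : j < τ + 1 - a + b) (hne : checkEntry a b τ Z C i j ≠ 0)
    (h : ∀ m < τ + 1 - a + b, m ≠ j → checkEntry a b τ Z C i m = 0 ∨ d m = 0) : d j = 0 := by
  have h1 := hd i hi
  rw [Finset.sum_eq_single_of_mem j (Finset.mem_range.mpr hj) fun m hm hmj =>
    mul_eq_zero.mpr (h m (Finset.mem_range.mp hm) hmj)] at h1
  exact (mul_eq_zero.mp h1).resolve_left hne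

include hp in
/-- The Cauchy part of a codeword vanishes if the codeword vanishes before a burst of length `b`
starting at `i`, and between the burst and the deadline `i + τ`. -/
theorem SatisfiesChecks.cauchy_eq_zero_of_burst (hd : SatisfiesChecks a b τ Z C d)
    (hZ : IsZeroBandMDS Z) (hC : IsCauchy C) {i : ℕ} (hi : i ≤ τ + 1 - a)
    (h1 : ∀ j < i, d j = 0) (h2 : ∀ j, i + b ≤ j → j ≤ i + τ → d j = 0) :
    ∀ j, b ≤ j → j ≤ τ → d j = 0 := by
  classical
  have hle := hp.le
  have hab := hp.a_le_b
  have ha := hp.a_pos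
  -- The number of tail columns hit by the burst; truncated subtraction gives `0` when the burst
  -- ends by `τ`.
  set r := i + b - 1 - τ with hr
  have hmin : pivotRow a '' (Set.Iio r) ⊆ Set.Iio (min i b) := by
    rintro _ ⟨s, hs, rfl⟩
    have hs : s < r := hs
    simp only [Set.mem_Iio, lt_min_iff, pivotRow]
    split_ifs <;> omega
  refine hd.cauchy_eq_zero hp hZ hC (Finset.range (min i b) \ (Finset.range r).image (pivotRow a))
    (Finset.Icc (max i b) (min τ (i + b - 1))) ?_ ?_ ?_ ?_ ?_
  · have h3 : ((Finset.range r).image (pivotRow a)).card = r := by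
      rw [Finset.card_image_of_injective _ pivotRow_strictMono.injective, Finset.card_range]
    have h4 : (Finset.range r).image (pivotRow a) ⊆ Finset.range (min i b) := by
      intro x hx
      obtain ⟨s, hs, rfl⟩ := Finset.mem_image.mp hx
      exact Finset.mem_range.mpr (hmin ⟨s, Finset.mem_range.mp hs, rfl⟩)
    -- Equations and unknowns balance exactly, because `min i b + max i b = i + b`.
    rw [Finset.card_sdiff_of_subset h4, h3, Finset.card_range, Nat.card_Icc]
    omega
  · intro x hx
    have := Finset.mem_range.mp (Finset.mem_sdiff.mp hx).1
    omega
  · intro j hj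
    have := Finset.mem_Icc.mp hj
    omega
  · intro j hj1 hj2 hj
    rw [Finset.mem_Icc] at hj
    rcases lt_or_ge j i with h | h
    · exact h1 j h
    · exact h2 j (by omega) (by omega)
  · intro x hx j hj hj'
    obtain ⟨hx1, hx2⟩ := Finset.mem_sdiff.mp hx
    rw [Finset.mem_range] at hx1
    have hxr : ∀ s < r, pivotRow a s ≠ x := fun s hs h =>
      hx2 (Finset.mem_image.mpr ⟨s, Finset.mem_range.mpr hs, h⟩)
    rcases lt_or_ge j i with h | h
    · exact Or.inr (h1 j h)
    rcases hj' with hj' | hj'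
    · exact Or.inl (checkEntry_head_eq_zero hp Z C hZ (by omega) hj')
    by_cases hj2 : i + b ≤ j ∧ j ≤ i + τ
    · exact Or.inr (h2 j hj2.1 hj2.2)
    left
    by_cases hj3 : j < i + b
    · by_cases hx3 : ∃ s, pivotRow a s = x
      · obtain ⟨s, hs⟩ := hx3
        -- A remaining pivot row belongs to a tail column after the burst, so by echelon form it
        -- vanishes on all tail columns inside the burst.
        have hs' : r ≤ s := by_contra fun h => hxr s (by omega) hs
        have e : j = τ + 1 + (j - (τ + 1)) := by omega
        rw [e]
        refine checkEntry_tail_below hp Z C hZ (by omega) ?_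
        rw [← hs]
        exact pivotRow_strictMono (by omega)
      · push Not at hx3
        exact checkEntry_tail_of_forall_pivotRow_ne hp Z C hZ hj' hx3
    · exact checkEntry_tail_far hp Z C hZ (by omega) (by omega)

include hp in
/-- The first symbol of a burst of length `b` is recovered with delay `τ`. -/
theorem SatisfiesChecks.eq_zero_of_burst (hd : SatisfiesChecks a b τ Z C d)
    (hZ : IsZeroBandMDS Z) (hC : IsCauchy C) {i : ℕ} (hi : i < τ + 1 - a)
    (h1 : ∀ j < i, d j = 0) (h2 : ∀ j, i + b ≤ j → j ≤ i + τ → d j = 0) : d i = 0 := by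
  have hle := hp.le
  have hab := hp.a_le_b
  have ha := hp.a_pos
  have hc := hd.cauchy_eq_zero_of_burst hp hZ hC hi.le h1 h2
  rcases lt_or_ge i b with hib | hib
  · refine hd.eq_zero_of_row hib (by omega) (checkEntry_diag_ne_zero hp Z C hZ hib) ?_
    intro m hm hmi
    rcases lt_or_gt_of_ne hmi with h | h
    · exact Or.inr (h1 m h)
    rcases lt_or_ge m b with hmb | hmb
    · exact Or.inl (checkEntry_head_eq_zero hp Z C hZ h hmb)
    rcases le_or_gt m τ with hmτ | hmτ
    · exact Or.inr (hc m hmb hmτ)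
    rcases le_or_gt m (i + τ) with hmi | hmi
    · rcases lt_or_ge m (i + b) with hm2 | hm2
      · left
        have e : m = τ + 1 + (m - (τ + 1)) := by omega
        rw [e]
        -- From `m < i + b` and `a + b ≤ τ + 1` the offset `m - (τ + 1)` is below `i - a`, so the
        -- pivot of column `m` lies above row `i`.
        refine checkEntry_tail_below hp Z C hZ hib ?_
        unfold pivotRow
        split_ifs <;> omega
      · exact Or.inr (h2 m hm2 hmi)
    · exact Or.inl (checkEntry_tail_far hp Z C hZ hib (by omega))
  · exact hc i hib (by omega)

include hp in
/-- A codeword is determined by its first `τ + 1 - a` symbols. -/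
theorem SatisfiesChecks.eq_zero_of_message (hd : SatisfiesChecks a b τ Z C d)
    (hZ : IsZeroBandMDS Z) (hC : IsCauchy C) (h1 : ∀ j < τ + 1 - a, d j = 0)
    (h2 : ∀ j, τ + 1 - a + b ≤ j → d j = 0) : ∀ j, d j = 0 := by
  have hle := hp.le
  have hab := hp.a_le_b
  have ha := hp.a_pos
  -- The `b` parity symbols are regarded as a burst starting at `τ + 1 - a`.
  have hc := hd.cauchy_eq_zero_of_burst hp hZ hC le_rfl h1 fun j hj _ => h2 j hj
  have hτ : ∀ j ≤ τ, d j = 0 := fun j hj => by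
    rcases lt_or_ge j b with h | h
    · exact h1 j (by omega)
    · exact hc j h hj
  by_contra! hne
  obtain ⟨j₀, hj₀⟩ := hne
  have hbound : ∀ j, d j ≠ 0 → j ≤ τ + 1 - a + b := fun j hj =>
    by_contra fun h => hj (h2 j (by omega))
  classical
  -- Back substitution in the echelon tail: the pivot row of the last nonzero position sees nothing
  -- else.
  have hmax := Nat.findGreatest_spec (P := fun j => d j ≠ 0) (hbound j₀ hj₀) hj₀
  set m := Nat.findGreatest (fun j => d j ≠ 0) (τ + 1 - a + b) with hm
  have hgt : ∀ j, m < j → d j = 0 := fun j hj => by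
    by_contra hj0
    exact absurd (Nat.le_findGreatest (P := fun j => d j ≠ 0) (hbound j hj0) hj0) (by omega)
  have hmτ : τ < m := by_contra fun h => hmax (hτ m (by omega))
  have hmn : m < τ + 1 - a + b := by_contra fun h => hmax (h2 m (by omega))
  have e : τ + 1 + (m - (τ + 1)) = m := by omega
  have hpb : pivotRow a (m - (τ + 1)) < b := by
    unfold pivotRow
    split_ifs <;> omega
  refine hmax (hd.eq_zero_of_row hpb hmn ?_ ?_)
  · conv => enter [1]; rw [← e]
    simpa using checkEntry_pivot_ne_zero hp Z C hZ hpb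
  · intro j hj hjm
    rcases lt_or_gt_of_ne hjm with h | h
    · rcases le_or_gt j τ with h' | h'
      · exact Or.inr (hτ j h')
      · left
        have e : j = τ + 1 + (j - (τ + 1)) := by omega
        rw [e]
        exact checkEntry_tail_below hp Z C hZ hpb (pivotRow_strictMono (by omega))
    · exact Or.inr (hgt j h)

include hp in
/-- The first of at most `a` erased symbols in `[i, i + τ]` is recovered with delay `τ`. -/
theorem SatisfiesChecks.eq_zero_of_card_le (hd : SatisfiesChecks a b τ Z C d)
    (hZ : IsZeroBandMDS Z) (hC : IsCauchy C) {i : ℕ} (hi : i < τ + 1 - a)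
    (h1 : ∀ j < i, d j = 0) (J : Finset ℕ) (hJ : J.card ≤ a)
    (h2 : ∀ j, i ≤ j → j ≤ i + τ → j ∉ J → d j = 0) : d i = 0 := by
  classical
  have hle := hp.le
  have hab := hp.a_le_b
  have ha := hp.a_pos
  have hbl := hp.block_le hp.l_pos
  by_contra hne
  have hiJ : i ∈ J := by_contra fun h => hne (h2 i le_rfl (by omega) h)
  set S := J.filter fun j => b ≤ j ∧ j ≤ τ with hS
  have hSJ : S.card ≤ J.card := Finset.card_filter_le _ _
  have hSb : ∀ j ∈ S, b ≤ j ∧ j ≤ τ := fun j hj => (Finset.mem_filter.mp hj).2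
  have hdS : ∀ j, b ≤ j → j ≤ τ → j ∉ S → d j = 0 := by
    intro j hj1 hj2 hj
    rcases lt_or_ge j i with h | h
    · exact h1 j h
    · exact h2 j h (by omega) fun h => hj (Finset.mem_filter.mpr ⟨h, hj1, hj2⟩)
  have hlast : 2 * a - 2 < b := by omega
  rcases lt_or_ge i b with hib | hib
  swap
  -- The head is zero, so all `a` rows vanishing on the tail see only Cauchy columns.
  · refine hne (hd.cauchy_eq_zero hp hZ hC (insert (2 * a - 2) (Finset.range (a - 1))) S ?_ ?_
      hSb hdS ?_ i hib (by omega))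
    · rw [Finset.card_insert_of_notMem (by simp; omega), Finset.card_range]
      omega
    · intro x hx
      rcases Finset.mem_insert.mp hx with rfl | hx
      · exact hlast
      · have := Finset.mem_range.mp hx
        omega
    · intro x hx j hj hj'
      rcases hj' with hj' | hj'
      · exact Or.inr (h1 j (by omega))
      · left
        rcases Finset.mem_insert.mp hx with rfl | hx
        · exact checkEntry_tail_last hp Z C hZ hj'
        · exact checkEntry_tail_first hp Z C (Finset.mem_range.mp hx) hj'
  rcases hp.row_cases hib with hia | ⟨g, r, hg, hgl, hr, hir⟩
  · have hrow : ∀ x < a - 1, ∀ j, j ≠ x → (j < b ∨ τ < j) → checkEntry a b τ Z C x j = 0 := by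
      intro x hx j hjx hj
      rw [checkEntry_first hp Z C hx, if_neg hjx, if_neg (by omega)]
    suffices hc : ∀ j, b ≤ j → j ≤ τ → d j = 0 by
      refine hne (hd.eq_zero_of_row hib (by omega) (checkEntry_diag_ne_zero hp Z C hZ hib) ?_)
      intro m hm hmi
      by_cases hm : b ≤ m ∧ m ≤ τ
      · exact Or.inr (hc m hm.1 hm.2)
      · exact Or.inl (hrow i hia m hmi (by omega))
    -- Each erasure in the identity part spoils one of the first `a - 1` rows, leaving `a - 1 -
    -- A.card` usable checks.
    set A := J.filter fun j => j < a - 1 with hA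
    have hdisj : Disjoint S A := by
      rw [Finset.disjoint_left]
      intro x hx hx'
      have := (Finset.mem_filter.mp hx).2
      have := (Finset.mem_filter.mp hx').2
      omega
    have hAr : A ⊆ Finset.range (a - 1) := fun x hx =>
      Finset.mem_range.mpr (Finset.mem_filter.mp hx).2
    have hSA : S ∪ A ⊆ J := Finset.union_subset (Finset.filter_subset _ _)
      (Finset.filter_subset _ _)
    have hcardSA : S.card + A.card ≤ J.card := by
      rw [← Finset.card_union_of_disjoint hdisj]
      exact Finset.card_le_card hSA
    have hT0 : (Finset.range (a - 1) \ A).card = a - 1 - A.card := by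
      rw [Finset.card_sdiff_of_subset hAr, Finset.card_range]
    have hAcard : A.card ≤ a - 1 := by simpa using Finset.card_le_card hAr
    have hT0row : ∀ x ∈ Finset.range (a - 1) \ A, ∀ j < τ + 1 - a + b, (j < b ∨ τ < j) →
        checkEntry a b τ Z C x j = 0 ∨ d j = 0 := by
      intro x hx j _ hj
      obtain ⟨hx1, hx2⟩ := Finset.mem_sdiff.mp hx
      rw [Finset.mem_range] at hx1
      by_cases hjx : j = x
      · right
        subst hjx
        rcases lt_or_ge j i with h | h
        · exact h1 j h
        · exact h2 j h (by omega) fun h => hx2 (Finset.mem_filter.mpr ⟨h, hx1⟩)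
      · exact Or.inl (hrow x hx1 j hjx hj)
    rcases le_or_gt (S.card + A.card) (a - 1) with hsmall | hbig
    · refine hd.cauchy_eq_zero hp hZ hC (Finset.range (a - 1) \ A) S (by omega) ?_ hSb hdS hT0row
      intro x hx
      have := Finset.mem_range.mp (Finset.mem_sdiff.mp hx).1
      omega
    -- One check is missing, but now all `a` erasures are in `S ∪ A`. The head columns `a - 1, …, b
    -- - 1` are thus unerased, and row `2a - 2` becomes the extra check.
    · have hJeq : S ∪ A = J := Finset.eq_of_subset_of_card_le hSA
        (by rw [Finset.card_union_of_disjoint hdisj]; omega)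
      refine hd.cauchy_eq_zero hp hZ hC (insert (2 * a - 2) (Finset.range (a - 1) \ A)) S ?_ ?_
        hSb hdS ?_
      · rw [Finset.card_insert_of_notMem (by simp; omega)]
        omega
      · intro x hx
        rcases Finset.mem_insert.mp hx with rfl | hx
        · exact hlast
        · have := Finset.mem_range.mp (Finset.mem_sdiff.mp hx).1
          omega
      · intro x hx j hj hj'
        rcases Finset.mem_insert.mp hx with rfl | hx
        · rcases hj' with hj' | hj'
          · by_cases hj1 : a - 1 ≤ j
            · right
              refine h2 j (by omega) (by omega) fun hjJ => ?_
              rw [← hJeq] at hjJ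
              rcases Finset.mem_union.mp hjJ with h | h
              · have := hSb j h
                omega
              · have := (Finset.mem_filter.mp h).2
                omega
            · left
              have h := checkEntry_block hp Z C hZ (j := j) le_rfl hp.l_pos
                (show a - 1 < a by omega)
              have := hp.tailStart_bounds (le_refl 1)
              rw [show 1 * a - 1 + (a - 1) = 2 * a - 2 by omega] at h
              rw [h, if_neg (by omega), if_neg (by omega), if_neg (by omega), add_zero, add_zero]
          · exact Or.inl (checkEntry_tail_last hp Z C hZ hj')
        · exact hT0row x hx j hj hj'
  · have hga := Nat.le_mul_of_pos_left a hg
    have hbg := hp.block_le hgl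
    have hts := hp.tailStart_bounds hg
    have hc : ∀ j, b ≤ j → j ≤ τ → d j = 0 := by
      refine hd.cauchy_eq_zero hp hZ hC (Finset.range (a - 1)) S ?_ ?_ hSb hdS ?_
      · rw [Finset.card_range]
        -- The erased symbol `i` is in the head, so at most `a - 1` Cauchy symbols are erased and
        -- the first `a - 1` rows suffice.
        have : S ⊆ J.erase i := fun x hx => by
          refine Finset.mem_erase.mpr ⟨?_, (Finset.mem_filter.mp hx).1⟩
          have := hSb x hx
          omega
        have := Finset.card_le_card this
        rw [Finset.card_erase_of_mem hiJ] at this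
        omega
      · intro x hx
        have := Finset.mem_range.mp hx
        omega
      · intro x hx j hj hj'
        have := Finset.mem_range.mp hx
        rcases lt_or_ge j i with h | h
        · exact Or.inr (h1 j h)
        · left
          rw [checkEntry_first hp Z C this, if_neg (by omega), if_neg (by omega)]
    -- the coefficients of the columns of `Z` in the block of rows `g`
    let ts := tailStart a τ g
    let pos : ℕ → ℕ := fun j => if j < a then g * a - 1 + j else ts + (j - a)
    -- The guard fails only for `g = 1` at the last column of `Z`, which the truncation removed; its
    -- coefficient is set to `0`.
    let w : Fin (2 * a) → F := fun j => if pos j < τ + g * a then d (pos j) else 0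
    have hpos_inj : ∀ x y : Fin (2 * a), pos x = pos y → x = y := by
      intro x y hxy
      ext
      simp only [pos, ts] at hxy
      split_ifs at hxy <;> omega
    have hw : w = 0 := by
      refine hZ.eq_zero_of_sum_eq_zero w (Finset.univ.filter fun j => pos j ∈ J) ?_ ?_ ?_
      · refine le_trans ?_ hJ
        refine Finset.card_le_card_of_injOn (fun j : Fin (2 * a) => pos j) ?_ ?_
        · intro x hx
          simpa using hx
        · intro x _ y _ hxy
          exact hpos_inj x y hxy
      · intro x hx
        have hx : pos x ∉ J := by simpa using hx
        simp only [w]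
        split_ifs with h
        · rcases lt_or_ge (pos x) i with h' | h'
          · exact h1 _ h'
          -- Every symbol of block `g` meets the deadline: `pos x ≤ τ + g * a - 1 ≤ i + τ`.
          · refine h2 _ h' ?_ hx
            omega
        · rfl
      · intro x
        rw [← hd (g * a - 1 + x) (by omega)]
        simp only [w, mul_ite, mul_zero]
        rw [← Finset.sum_filter]
        refine Finset.sum_of_injOn (fun y : Fin (2 * a) => pos y)
          (fun y _ z _ hyz => hpos_inj y z hyz) ?_ ?_ ?_
        · intro y hy
          have hy : pos y < τ + g * a := by simpa using hy
          have : pos y ∈ Finset.range (τ + 1 - a + b) := Finset.mem_range.mpr (by omega)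
          exact this
        · intro j _ hj
          rw [checkEntry_block hp Z C hZ hg hgl x.2]
          have hj' : ∀ y < 2 * a, pos y < τ + g * a → pos y ≠ j := fun y hy hy1 hy2 =>
            hj ⟨⟨y, hy⟩, by simpa using hy1, hy2⟩
          have hj1 : ¬(g * a - 1 ≤ j ∧ j < g * a - 1 + a) := by
            intro h
            have e : pos (j - (g * a - 1)) = j := by
              simp only [pos]
              rw [if_pos (by omega)]
              omega
            exact hj' _ (by omega) (by omega) e
          have hj2 : ¬(ts ≤ j ∧ j < τ + g * a) := by
            intro h
            have e : pos (a + (j - ts)) = j := by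
              simp only [pos]
              rw [if_neg (by omega)]
              omega
            exact hj' _ (by omega) (by omega) e
          rw [if_neg hj1, if_neg hj2, zero_add, add_zero]
          split_ifs with h
          · rw [hc j h.1 h.2, mul_zero]
          · rw [zero_mul]
        · intro y hy
          have hy : pos y < τ + g * a := by simpa using hy
          refine congrArg (· * d (pos y)) ?_
          rw [checkEntry_block hp Z C hZ hg hgl x.2]
          by_cases hya : (y : ℕ) < a
          · have e : pos y = g * a - 1 + y := if_pos hya
            rw [if_pos (by omega), if_neg (c := b ≤ _ ∧ _) (by omega),
              if_neg (c := tailStart a τ g ≤ _ ∧ _) (by omega), add_zero, add_zero, e,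
              Nat.add_sub_cancel_left, natEntry_val]
          · have e : pos y = tailStart a τ g + (y - a) := if_neg hya
            have e' : a + ((y : ℕ) - a) = y := by omega
            rw [if_neg (by omega), if_neg (c := b ≤ _ ∧ _) (by omega),
              if_pos (c := tailStart a τ g ≤ _ ∧ _) (by omega), zero_add, zero_add, e,
              Nat.add_sub_cancel_left, e', natEntry_val]
    have hwr := congrFun hw ⟨r, by omega⟩
    simp only [w, pos, if_pos hr, ← hir, Pi.zero_apply] at hwr
    rw [if_pos (by omega)] at hwr
    exact hne hwr

end Code
end StreamingCode

/-! ### Diagonal embedding, and transfer from block code to streaming code. -/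

namespace StreamingCode

universe u

variable {F : Type u}

section Packet

variable {k r : ℕ}

theorem PacketCode.ext {P Q : PacketCode F k r} (h : ∀ u t j, P.parity u t j = Q.parity u t j) :
    P = Q := by
  cases P
  cases Q
  simp only [PacketCode.mk.injEq]
  exact funext fun u => funext fun t => funext fun j => h u t j

theorem PacketCode.packet_congr (P : PacketCode F k r) {u v : ℕ → Fin k → F} {t : ℕ}
    (h : ∀ s ≤ t, u s = v s) : P.packet u t = P.packet v t := by
  rw [PacketCode.packet, PacketCode.packet, h t le_rfl, P.causal u v t h]

theorem PacketCode.packet_castAdd (P : PacketCode F k r) (u : ℕ → Fin k → F) (t : ℕ) (i : Fin k) :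
    P.packet u t (Fin.castAdd r i) = u t i :=
  Fin.append_left _ _ i

theorem PacketCode.packet_natAdd (P : PacketCode F k r) (u : ℕ → Fin k → F) (t : ℕ) (j : Fin r) :
    P.packet u t (Fin.natAdd k j) = P.parity u t j :=
  Fin.append_right _ _ j

variable [Field F]

/-- The message symbols on the diagonal starting at time `T`. -/
def diagonalMessage (u : ℕ → Fin k → F) (T : ℤ) : Fin k → F :=
  fun i => if 0 ≤ T + ((i : ℕ) : ℤ) then u (T + ((i : ℕ) : ℤ)).toNat i else 0

/-- The restriction of a block code of length `k + r` to its first `k` symbols. -/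
def messagePart (C : Submodule F (Fin (k + r) → F)) : C →ₗ[F] (Fin k → F) :=
  (LinearMap.funLeft F F (Fin.castAdd r)).comp C.subtype

theorem messagePart_apply (C : Submodule F (Fin (k + r) → F)) (c : C) (i : Fin k) :
    messagePart C c i = c.1 (Fin.castAdd r i) := rfl

variable {C : Submodule F (Fin (k + r) → F)}

/-- Parity symbol `j` at time `t` lies on the diagonal starting at `t - (k + j)`, whose codeword is
fixed by its message part. This gives uniqueness of the embedding. -/
theorem PacketCode.IsDiagonalEmbedding.parity_eq {P : PacketCode F k r}
    (hP : P.IsDiagonalEmbedding C) (u : ℕ → Fin k → F) (t : ℕ) (j : Fin r) {c : C}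
    (hinj : Function.Injective (messagePart C))
    (hc : messagePart C c = diagonalMessage u ((t : ℤ) - (k + (j : ℕ)))) :
    P.parity u t j = c.1 (Fin.natAdd k j) := by
  have h1 := hP u ((t : ℤ) - (k + (j : ℕ)))
  have h2 : (⟨_, h1⟩ : C) = c := by
    refine hinj (funext fun i => ?_)
    rw [hc, messagePart_apply]
    simp only [P.packet_castAdd, Fin.val_castAdd, diagonalMessage]
  rw [← h2]
  simp only [P.packet_natAdd, Fin.val_natAdd]
  have h3 : (t : ℤ) - (k + (j : ℕ)) + ((k + j : ℕ) : ℤ) = t := by push_cast; ring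
  rw [h3, if_pos (by omega), Int.toNat_natCast]

/-- The diagonal embedding of a block code whose first `k` symbols form an information set. -/
noncomputable def diagonalCode (e : C ≃ₗ[F] (Fin k → F)) : PacketCode F k r where
  parity u t j := (e.symm (diagonalMessage u ((t : ℤ) - (k + (j : ℕ))))).1 (Fin.natAdd k j)
  causal u v t h := by
    funext j
    have : diagonalMessage u ((t : ℤ) - (k + (j : ℕ))) =
        diagonalMessage v ((t : ℤ) - (k + (j : ℕ))) := by
      funext i
      unfold diagonalMessage
      split_ifs with hi
      · rw [h _ (by omega)]
      · rfl
    simp only [this]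

theorem diagonalCode_isDiagonalEmbedding (e : C ≃ₗ[F] (Fin k → F))
    (he : ∀ c, e c = messagePart C c) : (diagonalCode e).IsDiagonalEmbedding C := by
  intro u T
  convert (e.symm (diagonalMessage u T)).2 using 1
  funext i
  refine Fin.addCases (fun i => ?_) (fun j => ?_) i
  · have h1 := he (e.symm (diagonalMessage u T))
    rw [LinearEquiv.apply_symm_apply] at h1
    have h2 := congrFun h1 i
    rw [messagePart_apply] at h2
    rw [← h2]
    simp only [PacketCode.packet_castAdd, Fin.val_castAdd, diagonalMessage]
  · simp only [PacketCode.packet_natAdd, Fin.val_natAdd]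
    split_ifs with h
    · have h3 : ((T + ((k + j : ℕ) : ℤ)).toNat : ℤ) - (k + (j : ℕ)) = T := by omega
      simp only [diagonalCode, h3]
    -- Message positions precede the parity position on the diagonal, so they too are at negative
    -- times and the codeword is zero.
    · have h3 : diagonalMessage u T = 0 := by
        funext i
        exact if_neg (by omega)
      rw [h3, map_zero]
      rfl

theorem existsUnique_diagonalEmbedding (h : Function.Bijective (messagePart C)) :
    ∃! P : PacketCode F k r, P.IsDiagonalEmbedding C := by
  let e := LinearEquiv.ofBijective _ h
  refine ⟨diagonalCode e, diagonalCode_isDiagonalEmbedding e fun _ => rfl, ?_⟩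
  intro P hP
  refine PacketCode.ext fun u t j => ?_
  exact hP.parity_eq u t j h.1 (c := e.symm (diagonalMessage u ((t : ℤ) - (k + (j : ℕ)))))
    (e.apply_symm_apply _)

end Packet

section Base

variable [Field F] {a b τ l : ℕ} (hp : Params a b τ l) {Z : Matrix (Fin a) (Fin (2 * a)) F}
  {C : Matrix (Fin b) (Fin (τ + 1 - b)) F}

include hp

theorem messagePart_baseCode_injective (hZ : IsZeroBandMDS Z) (hC : IsCauchy C) :
    Function.Injective (messagePart (baseCode a b τ Z C)) := by
  rw [← LinearMap.ker_eq_bot, LinearMap.ker_eq_bot']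
  intro c hc
  have h := (satisfiesChecks_of_mem c.2).eq_zero_of_message hp hZ hC ?_ ?_
  · ext j
    simpa using h j
  · intro j hj
    rw [dif_pos (by omega)]
    exact congrFun hc ⟨j, hj⟩
  · intro j hj
    rw [dif_neg (by omega)]

/-- Injectivity of `messagePart` bounds the dimension above; rank-nullity with `b` checks bounds it
below. -/
theorem finrank_baseCode (hZ : IsZeroBandMDS Z) (hC : IsCauchy C) :
    Module.finrank F (baseCode a b τ Z C) = τ + 1 - a := by
  refine le_antisymm ?_ ?_
  · simpa using LinearMap.finrank_le_finrank_of_injective (messagePart_baseCode_injective hp hZ hC)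
  · have h1 := LinearMap.finrank_range_add_finrank_ker (parityCheck a b τ Z C).mulVecLin
    have h2 := Submodule.finrank_le (LinearMap.range (parityCheck a b τ Z C).mulVecLin)
    simp only [Module.finrank_fin_fun] at h1 h2
    rw [baseCode]
    omega

theorem messagePart_baseCode_bijective (hZ : IsZeroBandMDS Z) (hC : IsCauchy C) :
    Function.Bijective (messagePart (baseCode a b τ Z C)) := by
  have h := messagePart_baseCode_injective hp hZ hC
  exact ⟨h, (LinearMap.injective_iff_surjective_of_finrank_eq_finrank
    (by rw [finrank_baseCode hp hZ hC, Module.finrank_fin_fun])).mp h⟩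

theorem isStreaming_of_isDiagonalEmbedding (hZ : IsZeroBandMDS Z) (hC : IsCauchy C)
    {P : PacketCode F (τ + 1 - a) b} (hP : P.IsDiagonalEmbedding (baseCode a b τ Z C)) :
    P.IsStreaming a b τ := by
  classical
  have hle := hp.le
  intro E hE t u v
  induction t using Nat.strong_induction_on with
  | _ t ih =>
  intro huv
  have hpast : ∀ s < t, u s = v s := fun s hs => ih s hs fun s' hs' h => huv s' (by omega) h
  have hpackets : ∀ s < t, P.packet u s = P.packet v s := fun s hs =>
    P.packet_congr fun s' hs' => hpast s' (by omega)
  funext i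
  -- The diagonal starting at time `t - i` carries the symbol `i` of packet `t`.
  have hD := satisfiesChecks_of_mem (Submodule.sub_mem _ (hP u ((t : ℤ) - (i : ℕ)))
    (hP v ((t : ℤ) - (i : ℕ))))
  set d : ℕ → F := _ with hd
  change SatisfiesChecks a b τ Z C d at hD
  have hd0 : ∀ j s : ℕ, s + i = t + j → P.packet u s = P.packet v s → d j = 0 := by
    intro j s hs h
    simp only [hd]
    split_ifs with hj
    · have e : (t : ℤ) - (i : ℕ) + (j : ℕ) = s := by omega
      simp only [Pi.sub_apply, e, Int.toNat_natCast, h, sub_self]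
    · rfl
  have h1 : ∀ j < (i : ℕ), d j = 0 := by
    intro j hj
    by_cases h : (i : ℕ) ≤ t + j
    · exact hd0 j (t + j - i) (by omega) (hpackets _ (by omega))
    · simp only [hd]
      rw [dif_pos (by omega)]
      simp only [Pi.sub_apply]
      rw [if_neg (by omega), if_neg (by omega), sub_zero]
  have h2 : ∀ j, (i : ℕ) ≤ j → j ≤ i + τ → t + (j - i) ∉ E → d j = 0 := fun j hj hj' h =>
    hd0 j (t + (j - i)) (by omega) (huv _ (by omega) h)
  suffices h : d i = 0 by
    have hi : (i : ℕ) < τ + 1 - a + b := by omega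
    simp only [hd, dif_pos hi] at h
    have e : (t : ℤ) - (i : ℕ) + (i : ℕ) = t := by omega
    have e' : (⟨i, hi⟩ : Fin (τ + 1 - a + b)) = Fin.castAdd b i := rfl
    simp only [Pi.sub_apply, e', P.packet_castAdd, Fin.val_castAdd, e, Int.toNat_natCast] at h
    rw [if_pos (by omega), if_pos (by omega)] at h
    exact sub_eq_zero.mp h
  rcases hE t with h | ⟨s, hs⟩
  · refine hD.eq_zero_of_card_le hp hZ hC i.2 h1
      ((Finset.Icc (i : ℕ) (i + τ)).filter fun j => t + (j - i) ∈ E) (le_trans ?_ h)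
      fun j hj hj' hj'' => h2 j hj hj' fun hE => hj''
        (Finset.mem_filter.mpr ⟨Finset.mem_Icc.mpr ⟨hj, hj'⟩, hE⟩)
    rw [← Set.ncard_coe_finset]
    refine Set.ncard_le_ncard_of_injOn (fun j => t + (j - i)) ?_ ?_
      ((Set.finite_Icc _ _).inter_of_right _)
    · intro j hj
      have hj := Finset.mem_filter.mp (Finset.mem_coe.mp hj)
      have := Finset.mem_Icc.mp hj.1
      exact ⟨hj.2, Set.mem_Icc.mpr ⟨by omega, by omega⟩⟩
    · intro j hj j' hj' hjj'
      have hj := Finset.mem_Icc.mp (Finset.mem_filter.mp (Finset.mem_coe.mp hj)).1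
      have hj' := Finset.mem_Icc.mp (Finset.mem_filter.mp (Finset.mem_coe.mp hj')).1
      have hjj' : t + (j - i) = t + (j' - i) := hjj'
      omega
  · by_cases ht : t ∈ E
    · have hst := hs ⟨ht, Set.mem_Icc.mpr ⟨le_rfl, by omega⟩⟩
      refine hD.eq_zero_of_burst hp hZ hC i.2 h1 fun j hj hj' => h2 j (by omega) hj' fun hE => ?_
      have := hs ⟨hE, Set.mem_Icc.mpr ⟨by omega, by omega⟩⟩
      rw [Set.mem_Ico] at hst this
      omega
    · exact hd0 i t (by omega) (huv t (by omega) ht)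

end Base

end StreamingCode

/-! ### The converse: an upper bound on the rate. -/

namespace StreamingCode

universe u

/-- Periodic bursts of `b` erasures separated by `m` unerased slots. -/
def periodicErasures (m b : ℕ) : Set ℕ := {t | t % (m + b) < b}

theorem admissible_periodicErasures {a b τ : ℕ} (hle : a ≤ τ + 1) (hab : a ≤ b) :
    Admissible a b τ (periodicErasures (τ + 1 - a) b) := by
  intro t
  set N := τ + 1 - a + b with hN
  have hE : ∀ x, x ∈ periodicErasures (τ + 1 - a) b ↔ x % N < b := fun x => Iff.rfl
  have hN0 : 0 < N := by omega
  have ht := Nat.div_add_mod t N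
  have hρ := Nat.mod_lt t hN0
  set ρ := t % N
  set T := N * (t / N) with hT
  have hmod : ∀ x, T ≤ x → x < T + N → x % N = x - T := by
    intro x h1 h2
    have e : x = N * (t / N) + (x - T) := by omega
    conv_lhs => rw [e]
    rw [Nat.mul_add_mod, Nat.mod_eq_of_lt (by omega)]
  have hmod' : ∀ x, T + N ≤ x → x < T + N + N → x % N = x - T - N := by
    intro x h1 h2
    rw [Nat.mod_eq_sub_mod (by omega), hmod (x - N) (by omega) (by omega)]
    omega
  rcases lt_or_ge ρ b with hρb | hρb
  · by_cases hlast : t + τ < T + N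
    · refine Or.inr ⟨T, fun x hx => ?_⟩
      have h1 := (hE x).mp hx.1
      have h2 := Set.mem_Icc.mp hx.2
      rw [hmod x (by omega) (by omega)] at h1
      exact Set.mem_Ico.mpr (by omega)
    -- The window meets two bursts. It has `τ + 1` slots and contains the entire gap of `τ + 1 - a`
    -- unerased ones, so at most `a` are erased.
    · left
      have hsub : periodicErasures (τ + 1 - a) b ∩ Set.Icc t (t + τ) ⊆
          (Finset.Ico t (T + b) ∪ Finset.Ico (T + N) (t + τ + 1) : Finset ℕ) := by
        intro x hx
        have h1 := (hE x).mp hx.1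
        have h2 := Set.mem_Icc.mp hx.2
        rw [Finset.mem_coe, Finset.mem_union, Finset.mem_Ico, Finset.mem_Ico]
        by_cases hxN : x < T + N
        · rw [hmod x (by omega) hxN] at h1
          omega
        · omega
      refine (Set.ncard_le_ncard hsub (Finset.finite_toSet _)).trans ?_
      rw [Set.ncard_coe_finset]
      refine (Finset.card_union_le _ _).trans ?_
      rw [Nat.card_Ico, Nat.card_Ico]
      omega
  -- A window starting in a gap is no longer than a period, as `a ≤ b`, so it meets only the next
  -- burst.
  · refine Or.inr ⟨T + N, fun x hx => ?_⟩
    have h1 := (hE x).mp hx.1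
    have h2 := Set.mem_Icc.mp hx.2
    rw [Set.mem_Ico]
    by_cases hxN : x < T + N
    · rw [hmod x (by omega) hxN] at h1
      omega
    · rw [hmod' x (by omega) (by omega)] at h1
      omega

/-- No streaming code exceeds the optimal rate. -/
theorem PacketCode.IsStreaming.mul_le {F : Type u} [Field F] [Finite F] {a b τ k r : ℕ}
    (hle : a ≤ τ) (hab : a ≤ b) {P : PacketCode F k r} (hP : P.IsStreaming a b τ) :
    (τ + 1 - a + b) * k ≤ (τ + 1 - a) * (k + r) := by
  have hadm := admissible_periodicErasures (a := a) (b := b) (τ := τ) (by omega) hab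
  set m := τ + 1 - a with hm
  set N := m + b with hN
  have hN0 : 0 < N := by omega
  -- Arbitrary messages in the first `M` periods, followed by zeros, are determined by the `m`
  -- unerased packets in each of `M + τ` periods; the extra `τ` periods cover all deadlines since `N
  -- ≥ 1`.
  have key : ∀ M : ℕ, M * (N * k) ≤ (M + τ) * (m * (k + r)) := by
    intro M
    let ext : (Fin (M * N) → Fin k → F) → ℕ → Fin k → F := fun w s =>
      if h : s < M * N then w ⟨s, h⟩ else 0
    let rcv : (Fin (M * N) → Fin k → F) → (Fin (M + τ) × Fin m) → Fin (k + r) → F :=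
      fun w qy => P.packet (ext w) (N * qy.1 + (b + qy.2))
    have hinj : Function.Injective rcv := by
      intro w w' hww
      funext t
      have h := hP _ hadm t (ext w) (ext w') ?_
      · simpa [ext] using h
      · intro s hs hsE
        have hsE : ¬ s % N < b := hsE
        have h1 := Nat.div_add_mod s N
        have h2 := Nat.mod_lt s hN0
        have h3 : s / N < M + τ := by
          rw [Nat.div_lt_iff_lt_mul hN0, Nat.add_mul]
          have := Nat.le_mul_of_pos_right τ hN0
          omega
        have h4 := congrFun hww (⟨s / N, h3⟩, ⟨s % N - b, by omega⟩)
        have e : N * (s / N) + (b + (s % N - b)) = s := by omega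
        simpa only [rcv, e] using h4
    have hcard := Nat.card_le_card_of_injective rcv hinj
    simp only [Nat.card_fun, Nat.card_eq_fintype_card (α := Fin _), Fintype.card_fin,
      Nat.card_prod] at hcard
    rw [← pow_mul, ← pow_mul] at hcard
    have := (Nat.pow_le_pow_iff_right Finite.one_lt_card).mp hcard
    calc M * (N * k) = k * (M * N) := by ring
      _ ≤ (k + r) * ((M + τ) * m) := this
      _ = _ := by ring
  by_contra! hlt
  -- The boundary term `τ * (m * (k + r))` does not grow with `M`, while a strict violation gains at
  -- least `1` per period; this `M` overtakes it.
  have h1 := key (τ * (m * (k + r)) + 1)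
  have h2 := Nat.mul_le_mul_left (τ * (m * (k + r)) + 1) (Nat.succ_le_of_lt hlt)
  rw [Nat.mul_succ] at h2
  rw [Nat.add_mul _ τ] at h1
  omega

end StreamingCode

/-! ### Existence of the matrices and of a field of linear size. -/

namespace StreamingCode

universe u

variable {F : Type u} [Field F]

/-- Evaluations of products of `a - 1` linear factors give a zero-band MDS generator matrix. -/
theorem exists_isZeroBandMDS {a : ℕ} (ha : 1 ≤ a) (α : Fin (2 * a) → F)
    (hα : Function.Injective α) : ∃ Z : Matrix (Fin a) (Fin (2 * a)) F, IsZeroBandMDS Z := by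
  classical
  -- The band of row `i` ends at `i + a - 1 < 2 * a`, so it never wraps around. The rows are
  -- evaluations of polynomials of degree `a - 1`, hence codewords of a Reed–Solomon code.
  let idx : Fin a → Fin (a - 1) → Fin (2 * a) := fun i s => ⟨i + 1 + s, by omega⟩
  let p : Fin a → Polynomial F := fun i => ∏ s, (Polynomial.X - Polynomial.C (α (idx i s)))
  let Z : Matrix (Fin a) (Fin (2 * a)) F := fun i j => (p i).eval (α j)
  have hZ : ∀ i j, Z i j = ∏ s, (α j - α (idx i s)) := fun i j => by
    simp [Z, p, Polynomial.eval_prod]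
  have hzero : ∀ (i : Fin a) (j : Fin (2 * a)), (i : ℕ) < j → (j : ℕ) < i + a → Z i j = 0 := by
    intro i j h1 h2
    have e : j = idx i ⟨j - i - 1, by omega⟩ := Fin.ext (by simp only [idx]; omega)
    rw [hZ, Finset.prod_eq_zero (Finset.mem_univ ⟨j - i - 1, by omega⟩)]
    rw [← e, sub_self]
  have hdiag : ∀ i : Fin a, Z i ⟨i, by omega⟩ ≠ 0 := by
    intro i
    rw [hZ]
    refine Finset.prod_ne_zero_iff.mpr fun s _ => sub_ne_zero.mpr fun h => ?_
    have := Fin.ext_iff.mp (hα h)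
    simp only [idx] at this
    omega
  have hlin : LinearIndependent F Z.row := by
    have hdet : (Z.submatrix id fun j : Fin a => (⟨j, by omega⟩ : Fin (2 * a))).det ≠ 0 := by
      rw [Matrix.det_of_isLowerTriangular _ fun i j hij => hzero i ⟨j, by omega⟩
        (OrderDual.toDual_lt_toDual.mp hij) (show (j : ℕ) < i + a by omega)]
      exact Finset.prod_ne_zero_iff.mpr fun i _ => hdiag i
    have h1 := Matrix.linearIndependent_rows_of_det_ne_zero hdet
    exact LinearIndependent.of_comp
      (LinearMap.funLeft F F fun j : Fin a => (⟨j, by omega⟩ : Fin (2 * a))) h1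
  refine ⟨Z, hlin, ?_, ?_⟩
  · intro c hc hc0
    rw [show Module.finrank F (Submodule.span F (Set.range Z.row)) = a by
      simpa using finrank_span_eq_card hlin]
    obtain ⟨v, rfl⟩ := (Submodule.mem_span_range_iff_exists_fun F).mp hc
    set f : Polynomial F := ∑ i, Polynomial.C (v i) * p i with hf
    have hcf : ∀ j, (∑ i, v i • Z.row i) j = f.eval (α j) := by
      intro j
      simp [hf, Polynomial.eval_finsetSum, Matrix.row, Z]
    have hdeg : f.degree < a := by
      rw [hf]
      refine (Polynomial.degree_sum_le _ _).trans_lt ?_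
      rw [Finset.sup_lt_iff (by exact WithBot.bot_lt_coe _)]
      intro i _
      rw [← Polynomial.smul_eq_C_mul]
      refine (Polynomial.degree_smul_le _ _).trans_lt ?_
      rw [Polynomial.degree_prod]
      simp only [Polynomial.degree_X_sub_C, Finset.sum_const, nsmul_eq_mul, mul_one,
        Finset.card_univ, Fintype.card_fin]
      exact Nat.cast_lt.mpr (by omega)
    by_contra hlt
    refine hc0 ?_
    have hf0 : f = 0 := by
      refine Polynomial.eq_zero_of_degree_lt_of_eval_index_eq_zero
        (Finset.univ.filter fun j => f.eval (α j) = 0) (hα.injOn) (hdeg.trans_le ?_)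
        fun j hj => (Finset.mem_filter.mp hj).2
      refine Nat.cast_le.mpr ?_
      have h1 := Finset.card_filter_add_card_filter_not (s := (Finset.univ : Finset (Fin (2 * a))))
        (fun j => f.eval (α j) = 0)
      rw [Finset.card_univ, Fintype.card_fin] at h1
      have h2 : hammingNorm (∑ i, v i • Z.row i) =
          (Finset.univ.filter fun j => ¬ f.eval (α j) = 0).card := by
        rw [hammingNorm]
        simp only [hcf, ne_eq]
      have h3 : ¬ (2 * a + 1 ≤ hammingNorm (∑ i, v i • Z.row i) + a) := by convert hlt
      omega
    funext j
    rw [hcf, hf0, Polynomial.eval_zero, Pi.zero_apply]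
  · rintro i j ⟨s, h1, h2, h3⟩
    rw [Nat.mod_eq_of_lt (by omega)] at h3
    exact hzero i j (by omega) (by omega)

theorem exists_isCauchy {m n : ℕ} (α : Fin (m + n) → F) (hα : Function.Injective α) :
    ∃ C : Matrix (Fin m) (Fin n) F, IsCauchy C :=
  ⟨fun i j => (α (Fin.castAdd n i) - α (Fin.natAdd m j))⁻¹, fun i => α (Fin.castAdd n i),
    fun j => α (Fin.natAdd m j), hα.comp (Fin.castAdd_injective m n),
    hα.comp (Fin.natAdd_injective n m), fun i j h => by
      have := Fin.ext_iff.mp (hα h)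
      simp only [Fin.val_castAdd, Fin.val_natAdd] at this
      omega, fun _ _ => rfl⟩

theorem exists_injective_of_le_card {α : Type*} [Finite α] {n : ℕ} (h : n ≤ Nat.card α) :
    ∃ f : Fin n → α, Function.Injective f :=
  ⟨fun i => (Finite.equivFin α).symm (Fin.castLE h i),
    (Finite.equivFin α).symm.injective.comp (Fin.castLE_injective h)⟩

theorem exists_field_card (τ : ℕ) (hτ : 1 ≤ τ) :
    ∃ (F : Type) (_ : Field F) (_ : Finite F), τ + 1 ≤ Nat.card F ∧ Nat.card F ≤ 2 * τ := by
  -- The least power of two exceeding `τ` is at most `2 * τ`.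
  refine ⟨GaloisField 2 (Nat.log 2 τ + 1), inferInstance,
    inferInstance, ?_⟩
  rw [GaloisField.card 2 _ (Nat.succ_ne_zero _)]
  have h1 := Nat.lt_pow_succ_log_self (b := 2) one_lt_two τ
  have h2 := Nat.pow_log_le_self 2 (x := τ) (by omega)
  refine ⟨h1, ?_⟩
  rw [pow_succ]
  omega

end StreamingCode

theorem theorem4 (a b τ : ℕ) (ha : 1 ≤ a) (hab : a ≤ b) (hτ : a + b ≤ τ + 1)
    (hmod : b % a = a - 1) :
    -- for all choices of the two matrices, the construction gives a rate-optimal streaming code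
    (∀ (F : Type*) [Field F] [Finite F] (Z : Matrix (Fin a) (Fin (2 * a)) F)
        (C : Matrix (Fin b) (Fin (τ + 1 - b)) F),
      StreamingCode.IsZeroBandMDS Z → StreamingCode.IsCauchy C →
        Module.finrank F (StreamingCode.baseCode a b τ Z C) = τ + 1 - a ∧
        (∃! P : StreamingCode.PacketCode F (τ + 1 - a) b,
          P.IsDiagonalEmbedding (StreamingCode.baseCode a b τ Z C)) ∧
        ∀ P : StreamingCode.PacketCode F (τ + 1 - a) b,
          P.IsDiagonalEmbedding (StreamingCode.baseCode a b τ Z C) → P.IsRateOptimal a b τ) ∧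
    -- the two matrices exist over every finite field with at least `τ + 1` elements
    (∀ (F : Type*) [Field F] [Finite F], τ + 1 ≤ Nat.card F →
      ∃ (Z : Matrix (Fin a) (Fin (2 * a)) F) (C : Matrix (Fin b) (Fin (τ + 1 - b)) F),
        StreamingCode.IsZeroBandMDS Z ∧ StreamingCode.IsCauchy C) ∧
    -- there is such a field of size linear in `τ`
    (∃ (F : Type) (_ : Field F) (_ : Finite F), τ + 1 ≤ Nat.card F ∧ Nat.card F ≤ 2 * τ) := by
  have hp : StreamingCode.Params a b τ (b / a) :=
    ⟨ha, (Nat.one_le_div_iff ha).mpr hab, rfl, by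
      have := Nat.div_add_mod' b a
      omega, hτ⟩
  refine ⟨fun F _ _ Z C hZ hC => ⟨StreamingCode.finrank_baseCode hp hZ hC,
    StreamingCode.existsUnique_diagonalEmbedding
      (StreamingCode.messagePart_baseCode_bijective hp hZ hC), fun P hP =>
      ⟨StreamingCode.isStreaming_of_isDiagonalEmbedding hp hZ hC hP, ?_, ?_⟩⟩, ?_,
    StreamingCode.exists_field_card τ (by omega)⟩
  · unfold StreamingCode.PacketCode.rate StreamingCode.optimalRate
    rw [Nat.cast_sub (by omega), Nat.cast_add, Nat.cast_one]
  · intro F' _ _ k' r' P' hP'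
    have h := hP'.mul_le (by omega) hab
    unfold StreamingCode.PacketCode.rate
    rw [← Nat.cast_add, ← Nat.cast_add]
    -- A competing code may have empty packets; its rate `0 / 0` is then `0` by convention.
    rcases Nat.eq_zero_or_pos (k' + r') with h0 | h0
    · rw [h0, Nat.cast_zero, div_zero]
      positivity
    · rw [div_le_div_iff₀ (by exact_mod_cast h0) (by exact_mod_cast (by omega))]
      rw [mul_comm (k' : ℚ)]
      exact_mod_cast h
  · intro F _ _ hF
    -- Enough points exist because `2 * a ≤ a + b ≤ τ + 1`; the Cauchy matrix uses exactly `τ + 1`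
    -- points.
    obtain ⟨α, hα⟩ := StreamingCode.exists_injective_of_le_card (α := F) (n := 2 * a) (by omega)
    obtain ⟨β, hβ⟩ := StreamingCode.exists_injective_of_le_card (α := F) (n := b + (τ + 1 - b))
      (by omega)
    obtain ⟨Z, hZ⟩ := StreamingCode.exists_isZeroBandMDS ha α hα
    obtain ⟨C, hC⟩ := StreamingCode.exists_isCauchy β hβ
    exact ⟨Z, C, hZ, hC⟩
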